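/- Let $\tau$ be in the upper half-plane, $q=e^{2\pi i\tau}$, $\eta(\tau)=q^{1/24}\prod_{n\ge1}(1-q^n)$ and $\Delta(\tau)=\eta(\tau)^{24}$. For real $a,b$ put $$\vartheta\left[{a\atop b}\right](z,\tau)=\sum_{n\in\mathbb Z}\exp\bigl(i\pi(n+a)^2\tau+(n+a)(z+2\pi i b)\bigr),\qquad \vartheta_1(z)=\vartheta\left[{1/2\atop 1/2}\right](z,\tau).$$ Let $\alpha,\beta\in\mathbb R$, $\theta=e^{-2\pi i\alpha}$, $\phi=e^{-2\pi i\beta}$ with $(\theta,\phi)\ne(1,1)$, and let $\lambda\in[0,1)$ be such that $\phi=e^{2\pi i\lambda}$. Let $P_1(z)=P_1\left[{\theta\atop\phi}\right](z,\tau)$ be the analytic continuation to $\mathbb C\setminus 2\pi i(\mathbb Z\tau+\mathbb Z)$ of the series $-\sum_{n\in\mathbb Z+\lambda}\frac{e^{nz}}{1-\theta^{-1}q^n}$, which converges for $|q|<|e^z|<1$. For $k\ge1$ put $P_k(z)=\frac{(-1)^{k-1}}{(k-1)!}\,\frac{d^{k-1}}{dz^{k-1}}P_1(z)$, and for $k,l\ge1$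 put $$D\left[{\theta\atop\phi}\right](k,l,z,\tau)=(-1)^{k+1}\binom{k+l-2}{k-1}P_{k+l-1}(z),$$ which is the coefficient of $z_1^{k-1}z_2^{l-1}$ in the expansion of $P_1(z+z_1-z_2)$. Let $m_1,\dots,m_r$ and $n_1,\dots,n_s$ be non-negative integers with $\sum_i m_i=\sum_j n_j=N$, and let $x_1,\dots,x_r,y_1,\dots,y_s$ be complex numbers that are pairwise incongruent modulo $2\pi i(\mathbb Z\tau+\mathbb Z)$. Put $$\Theta_{r,s,(m,n)}(x,y,\tau)=\frac{\prod_{i,j}\vartheta_1(x_i-y_j)^{m_in_j}}{\prod_{i<k}\vartheta_1(x_i-x_k)^{m_im_k}\prod_{j<l}\vartheta_1(y_j-y_l)^{n_jn_l}},\qquad \Phi=\sum_{i,j}m_in_j-\sum_{i<k}m_im_k-\sum_{j<l}n_jn_l,$$ and let ${\bf D}_{r,s}$ be the $N\times N$ block matrix whose block $(a,b)$, $1\le a\le r$, $1\le b\le s$, is the $m_a\times n_b$ matrix with entries $D\left[{\theta\atop\phi}\right](i,j,x_a-y_b,\tau)$, $1\le i\le m_a$, $1\le j\le n_b$. If $\vartheta\left[{1/2-\beta\atop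 1/2+\alpha}\right]\bigl(\sum_i m_ix_i-\sum_j n_jy_j,\tau\bigr)\ne0$, then $$\eta(\tau)^{3\Phi}=(-i)^{\Phi}(-1)^{\Phi+N(N+1)/2}\;\frac{\vartheta\left[{1/2-\beta\atop 1/2+\alpha}\right](0,\tau)\;\Theta_{r,s,(m,n)}(x,y,\tau)}{\vartheta\left[{1/2-\beta\atop 1/2+\alpha}\right]\bigl(\sum_i m_ix_i-\sum_j n_jy_j,\tau\bigr)}\;\det{\bf D}_{r,s}.$$ The left side is $\Delta(\tau)^{\Phi/8}$, with the branch given by $\Delta^{1/8}=\eta^3$. In particular, if $\Phi=8\zeta$ with an integer $\zeta$, then $\Delta(\tau)^{\zeta}$ equals the right side. -/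

import Mathlib

open UpperHalfPlane

noncomputable section

namespace Garvan

/-- The period lattice `2πi(ℤτ + ℤ)`. -/
def lattice (τ : ℍ) : Set ℂ :=
  {z | ∃ a b : ℤ, z = 2 * Real.pi * Complex.I * (a * (τ : ℂ) + b)}

/-- The torus theta series with real characteristics,
`ϑ[a; b](z, τ) = ∑_{n ∈ ℤ} exp (iπ (n + a)² τ + (n + a)(z + 2πib))`. -/
def theta (a b : ℝ) (z : ℂ) (τ : ℍ) : ℂ :=
  ∑' n : ℤ, Complex.exp (Complex.I * Real.pi * ((n : ℂ) + a) ^ 2 * (τ : ℂ)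
    + ((n : ℂ) + a) * (z + 2 * Real.pi * Complex.I * b))

/-- The multiplier `θ = exp (-2πiα)`; also used for `φ = exp (-2πiβ)`. -/
def multiplier (t : ℝ) : ℂ := Complex.exp (-2 * Real.pi * Complex.I * t)

/-- For `φ` on the unit circle, the number `λ ∈ [0, 1)` with `φ = exp (2πiλ)`
(see `exp_lam` and `lam_mem`). -/
def lam (φ : ℂ) : ℝ := Int.fract (Complex.arg φ / (2 * Real.pi))

lemma lam_mem (φ : ℂ) : lam φ ∈ Set.Ico (0 : ℝ) 1 :=
  ⟨Int.fract_nonneg _, Int.fract_lt_one _⟩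

lemma exp_lam {φ : ℂ} (h : ‖φ‖ = 1) :
    Complex.exp (2 * Real.pi * Complex.I * lam φ) = φ := by
  have h1 : (2 * Real.pi * Complex.I * lam φ : ℂ)
      = (Complex.arg φ : ℂ) * Complex.I
        - (⌊Complex.arg φ / (2 * Real.pi)⌋ : ℤ) * (2 * Real.pi * Complex.I) := by
    have hpi : (Real.pi : ℂ) ≠ 0 := by exact_mod_cast Real.pi_ne_zero
    simp only [lam, Int.fract]
    push_cast
    field_simp
  rw [h1, Complex.exp_sub, Complex.exp_int_mul_two_pi_mul_I, div_one]
  have h2 := Complex.norm_mul_exp_arg_mul_I φ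
  rwa [h, Complex.ofReal_one, one_mul] at h2

/-- The series `-∑'_{n ∈ ℤ + λ} q_z^n / (1 - θ⁻¹ q^n)` with `q_z = exp z`, `q = exp (2πiτ)`, which
converges for `|q| < |q_z| < 1`.  For `θ = φ = 1` the term `n = 0` has denominator `0` and is
thereby omitted. -/
def deformedSeries (θ φ : ℂ) (z : ℂ) (τ : ℍ) : ℂ :=
  -∑' k : ℤ, Complex.exp (((k : ℂ) + lam φ) * z) /
    (1 - θ⁻¹ * Complex.exp (2 * Real.pi * Complex.I * (τ : ℂ) * ((k : ℂ) + lam φ)))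

/-- `F` is an analytic continuation of the series from the strip `|q| < |exp z| < 1` to the
complement of the period lattice.  That complement is connected, so two such `F` agree on it. -/
def IsContinuation (θ φ : ℂ) (τ : ℍ) (F : ℂ → ℂ) : Prop :=
  AnalyticOnNhd ℂ F (lattice τ)ᶜ ∧
    ∀ z : ℂ, -2 * Real.pi * τ.im < z.re → z.re < 0 → F z = deformedSeries θ φ z τ

/-- The deformed Weierstrass function `P₁[θ; φ](z, τ)`, for `z` off the period lattice: the
analytic continuation of its defining series.  Its values on the lattice (the poles) carry no
meaning. -/
def P1 (θ φ : ℂ) (z : ℂ) (τ : ℍ) : ℂ :=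
  Classical.epsilon (IsContinuation θ φ τ) z

/-- The higher deformed Weierstrass functions
`P_k[θ; φ](z, τ) = (-1)^(k-1) / (k-1)! · (d/dz)^(k-1) P₁[θ; φ](z, τ)`, for `k ≥ 1`. -/
def P (k : ℕ) (θ φ : ℂ) (z : ℂ) (τ : ℍ) : ℂ :=
  (-1) ^ (k - 1) / ((k - 1).factorial : ℂ) *
    iteratedDeriv (k - 1) (fun w => P1 θ φ w τ) z

/-- For `k, l ≥ 1`, the coefficient of `z₁^(k-1) z₂^(l-1)` in the expansion of
`P₁[θ; φ](z + z₁ - z₂, τ)`, that is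
`D[θ; φ](k, l, z, τ) = (-1)^(k+1) (k+l-2 choose k-1) P_{k+l-1}[θ; φ](z, τ)`. -/
def D (θ φ : ℂ) (k l : ℕ) (z : ℂ) (τ : ℍ) : ℂ :=
  (-1) ^ (k + 1) * ((k + l - 2).choose (k - 1) : ℂ) * P (k + l - 1) θ φ z τ

/-- The block matrix `𝐃_{r,s}`: the block `(a, b)` is the `m_a × n_b` matrix with entries
`D[θ; φ](i, j, x_a - y_b, τ)`, `1 ≤ i ≤ m_a`, `1 ≤ j ≤ n_b`. -/
def blockD (θ φ : ℂ) (τ : ℍ) {r s : ℕ} (m : Fin r → ℕ) (n : Fin s → ℕ)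
    (x : Fin r → ℂ) (y : Fin s → ℂ) :
    Matrix ((a : Fin r) × Fin (m a)) ((b : Fin s) × Fin (n b)) ℂ :=
  Matrix.of fun p t => D θ φ (p.2 + 1) (t.2 + 1) (x p.1 - y t.1) τ

/-- The determinant of `𝐃_{r,s}`, rows and columns being listed block after block in increasing
order (this is the order that `finSigmaFinEquiv` gives). -/
def detD (θ φ : ℂ) (τ : ℍ) {r s : ℕ} (m : Fin r → ℕ) (n : Fin s → ℕ)
    (hmn : ∑ i, m i = ∑ j, n j) (x : Fin r → ℂ) (y : Fin s → ℂ) : ℂ :=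
  ((blockD θ φ τ m n x y).submatrix
    (fun u : Fin (∑ i, m i) => finSigmaFinEquiv.symm u)
    (fun u : Fin (∑ i, m i) => finSigmaFinEquiv.symm (Fin.cast hmn u))).det

/-- The theta quotient `Θ_{r,s,(m,n)}(x, y, τ)`. -/
def bigTheta (τ : ℍ) {r s : ℕ} (m : Fin r → ℕ) (n : Fin s → ℕ)
    (x : Fin r → ℂ) (y : Fin s → ℂ) : ℂ :=
  (∏ i, ∏ j, theta (1 / 2) (1 / 2) (x i - y j) τ ^ (m i * n j)) /
    ((∏ i, ∏ k ∈ Finset.Ioi i, theta (1 / 2) (1 / 2) (x i - x k) τ ^ (m i * m k)) *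
      (∏ j, ∏ l ∈ Finset.Ioi j, theta (1 / 2) (1 / 2) (y j - y l) τ ^ (n j * n l)))

/-- The integer `Φ = ∑_{i,j} m_i n_j - ∑_{i<k} m_i m_k - ∑_{j<l} n_j n_l`. -/
def Phi {r s : ℕ} (m : Fin r → ℕ) (n : Fin s → ℕ) : ℤ :=
  (∑ i, ∑ j, (m i : ℤ) * n j) - (∑ i, ∑ k ∈ Finset.Ioi i, (m i : ℤ) * m k)
    - ∑ j, ∑ l ∈ Finset.Ioi j, (n j : ℤ) * n l

/-- The common factor
`ϑ[½-β; ½+α](0) Θ_{r,s,(m,n)}(x, y) / ϑ[½-β; ½+α](∑ m_i x_i - ∑ n_j y_j) · det 𝐃_{r,s}`. -/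
def thetaDet (α β : ℝ) (τ : ℍ) {r s : ℕ} (m : Fin r → ℕ) (n : Fin s → ℕ)
    (hmn : ∑ i, m i = ∑ j, n j) (x : Fin r → ℂ) (y : Fin s → ℂ) : ℂ :=
  theta (1 / 2 - β) (1 / 2 + α) 0 τ * bigTheta τ m n x y /
      theta (1 / 2 - β) (1 / 2 + α) (∑ i, (m i : ℂ) * x i - ∑ j, (n j : ℂ) * y j) τ *
    detD (multiplier α) (multiplier β) τ m n hmn x y

end Garvan

end

noncomputable section

namespace Garvan

open Finset Filter Topology

/-! Write `T` for ϑ₁, `S` for ϑ[½-β; ½+α], and `K(z) = T'(0)/S(0) · S(z)/T(z)`. The proof identifies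
P₁ with `K`, evaluates `det K(u_i - v_j)` in closed form, and lets the points coalesce into blocks.

The identification `P1_eq_kronecker` is a Liouville argument. The defining series is a geometric
series plus a series holomorphic on the doubled strip |Re z| < 2π Im τ. After the pole parts cancel,
the difference between `K` and the continued series is holomorphic there, with unimodular
multipliers along 2πi and 2πiτ. Its modulus is therefore determined on a compact rectangle and
attains its maximum, so the difference is constant. As the multipliers are not both 1, the constant
is 0 (`eq_zero_of_multipliers`).

The determinant is Frobenius's: `S` is, up to an exponential, a translate of `T`, and
`frobenius_det` follows by induction from a Schur complement and the three-term relation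
`theta_half_three_term`. Zeros and derivative of `T` come from the Jacobi triple product, which
gives `T'(0) = i η³`.

In `det_confluent` repeated points turn rows into Taylor coefficients, and each vanishing factor
`T(0)` becomes `T'(0)`. Applied to rows and then to columns, this gives the entries `D`. The power
of `T'(0)` is N from the prefactors of `K` plus ∑ C(m_i, 2) + ∑ C(n_j, 2) from coinciding pairs.
This total is Φ by `Phi_eq`; the rest is a sign count. -/

/-! ### Confluence of determinants. -/

/-- The order with which the `a`-th entry of a sequence repeats earlier entries. -/
def repeatCount {N : ℕ} (X : Fin N → ℂ) (a : Fin N) : ℕ := #{b ∈ Iio a | X b = X a}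

/-- The leading Taylor coefficient at `z` of a function with simple zeros, as far as `z = 0` is
concerned: its derivative at `0`, its value elsewhere. -/
def leading (f : ℂ → ℂ) (z : ℂ) : ℂ := if z = 0 then deriv f 0 else f z

/-- A zero at 0 lets one write f(u - x) = (u - x) · `dslope f 0 (u - x)`; the p-th derivative of (u
- x)^p G at x is p! G(x), and the slope at 0 is the derivative. -/
lemma iteratedDeriv_pow_mul {f R : ℂ → ℂ} {x : ℂ} (hf : AnalyticAt ℂ f 0) (hf0 : f 0 = 0)
    (hR : AnalyticAt ℂ R x) (p : ℕ) :
    iteratedDeriv p (fun u => f (u - x) ^ p * R u) x = p.factorial * deriv f 0 ^ p * R x := by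
  have key : ∀ (p : ℕ) (G : ℂ → ℂ), AnalyticAt ℂ G x →
      iteratedDeriv p (fun u => (u - x) ^ p * G u) x = p.factorial * G x := by
    intro p
    induction p with
    | zero => intro G _; simp
    | succ p ih =>
      intro G hG
      have h1 : (fun u => (u - x) ^ (p + 1) * G u) = fun u => (u - x) * ((u - x) ^ p * G u) := by
        funext u; ring
      have hH : AnalyticAt ℂ (fun u => (u - x) ^ p * G u) x := by fun_prop
      have h2 : AnalyticAt ℂ (fun u => u - x) x := by fun_prop
      rw [h1, iteratedDeriv_fun_mul h2.contDiffAt hH.contDiffAt, Finset.sum_eq_single 1]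
      · simp only [Nat.choose_one_right, iteratedDeriv_one, Nat.add_sub_cancel, ih G hG]
        simp [Nat.factorial_succ, mul_assoc]
      · intro i _ hi
        rcases i with _ | _ | i
        · simp
        · exact absurd rfl hi
        · have : iteratedDeriv (i + 1 + 1) (fun u : ℂ => u - x) x = 0 := by
            rw [iteratedDeriv_succ']
            have : deriv (fun u : ℂ => u - x) = fun _ => 1 := by
              funext u; simp
            rw [this]
            simp [iteratedDeriv_const]
          simp [this]
      · simp
  have hd : AnalyticAt ℂ (dslope f 0) 0 := by
    obtain ⟨ps, hps⟩ := hf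
    exact ⟨_, hps.has_fpower_series_dslope_fslope⟩
  have hd' : AnalyticAt ℂ (fun u => dslope f 0 (u - x)) x := by
    have h2 : AnalyticAt ℂ (fun u : ℂ => u - x) x := by fun_prop
    exact AnalyticAt.fun_comp (f := fun u : ℂ => u - x) (by simpa using hd) h2
  have hfe : (fun u => f (u - x) ^ p * R u)
      = fun u => (u - x) ^ p * (dslope f 0 (u - x) ^ p * R u) := by
    funext u
    have := sub_smul_dslope f 0 (u - x)
    rw [hf0] at this
    simp only [sub_zero, smul_eq_mul] at this
    rw [← mul_assoc, ← mul_pow, this]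
  rw [hfe, key p _ (by fun_prop)]
  simp [mul_assoc]

/-- The factors with `c b = x` combine to a p-th power of f(u - x), and the derivative of order p
replaces each by f'(0); the other factors are merely evaluated. This is exactly what `leading`
records. -/
lemma iteratedDeriv_prod_mul {ι : Type*} (s : Finset ι) (c : ι → ℂ) {f R : ℂ → ℂ} {x : ℂ}
    (hf : Differentiable ℂ f) (hf0 : f 0 = 0) (hR : AnalyticAt ℂ R x) :
    iteratedDeriv #{b ∈ s | c b = x} (fun u => (∏ b ∈ s, f (u - c b)) * R u) x
      = (#{b ∈ s | c b = x}).factorial * ((∏ b ∈ s, leading f (x - c b)) * R x) := by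
  have h1 : (fun u => (∏ b ∈ s, f (u - c b)) * R u)
      = fun u => f (u - x) ^ #{b ∈ s | c b = x} *
        ((∏ b ∈ s with ¬ c b = x, f (u - c b)) * R u) := by
    funext u
    rw [← Finset.prod_filter_mul_prod_filter_not s (fun b => c b = x), mul_assoc]
    congr 1
    rw [← Finset.prod_const]
    refine Finset.prod_congr rfl fun b hb => ?_
    rw [(Finset.mem_filter.1 hb).2]
  have hfa : ∀ b, AnalyticAt ℂ (fun u => f (u - c b)) x := fun b =>
    (hf.comp (differentiable_id.sub_const (c b))).analyticAt x
  rw [h1, iteratedDeriv_pow_mul (hf.analyticAt 0) hf0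
    ((Finset.analyticAt_fun_prod _ fun b _ => hfa b).fun_mul hR)]
  rw [← Finset.prod_filter_mul_prod_filter_not s (fun b => c b = x) (fun b => leading f (x - c b))]
  have h2 : ∏ b ∈ s with c b = x, leading f (x - c b) = deriv f 0 ^ #{b ∈ s | c b = x} := by
    rw [← Finset.prod_const]
    refine Finset.prod_congr rfl fun b hb => ?_
    simp [leading, (Finset.mem_filter.1 hb).2]
  have h3 : ∏ b ∈ s with ¬ c b = x, leading f (x - c b) = ∏ b ∈ s with ¬ c b = x, f (x - c b) := by
    refine Finset.prod_congr rfl fun b hb => ?_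
    have := (Finset.mem_filter.1 hb).2
    rw [leading, if_neg]
    rw [sub_eq_zero]
    exact fun h => this h.symm
  rw [h2, h3]
  ring

/-- Confluence: a determinant evaluation with one row per point passes to repeated points, the
repetitions being read as Taylor coefficients. -/
theorem det_confluent {N : ℕ} {f : Fin N → ℂ → ℂ} {U : Set ℂ} (hU : IsOpen U)
    (hf : ∀ b, AnalyticOnNhd ℂ (f b) U) {θ S h : ℂ → ℂ} (hθ : Differentiable ℂ θ) (hθ0 : θ 0 = 0)
    (hS : Differentiable ℂ S) (hh : AnalyticOnNhd ℂ h U)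
    (base : ∀ X : Fin N → ℂ, (∀ a, X a ∈ U) → (Matrix.of fun a b => f b (X a)).det
      = S (∑ a, X a) * (∏ a, h (X a)) * ∏ a, ∏ b ∈ Iio a, θ (X a - X b))
    (X : Fin N → ℂ) (hX : ∀ a, X a ∈ U) :
    (Matrix.of fun a b => iteratedDeriv (repeatCount X a) (f b) (X a)
        / (repeatCount X a).factorial).det
      = S (∑ a, X a) * (∏ a, h (X a)) * ∏ a, ∏ b ∈ Iio a, leading θ (X a - X b) := by
  -- Rows are treated one at a time: those before `t` are already Taylor coefficients, the others
  -- still plain values.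
  suffices H : ∀ t : ℕ, ∀ X : Fin N → ℂ, (∀ a, X a ∈ U) →
      (Matrix.of fun (a b : Fin N) => if (a : ℕ) < t then iteratedDeriv (repeatCount X a) (f b) (X a)
        / (repeatCount X a).factorial else f b (X a)).det
      = S (∑ a, X a) * (∏ a, h (X a)) * ∏ a : Fin N, ∏ b ∈ Iio a,
        if (a : ℕ) < t then leading θ (X a - X b) else θ (X a - X b) by
    simpa using H N X hX
  intro t
  induction t with
  | zero => simpa using base
  | succ t ih =>
    intro X hX
    by_cases htN : N ≤ t
    · have := ih X hX
      have h1 : ∀ a : Fin N, (a : ℕ) < t := fun a => lt_of_lt_of_le a.2 htN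
      have h2 : ∀ a : Fin N, (a : ℕ) < t + 1 := fun a => (h1 a).trans (Nat.lt_succ_self t)
      simpa only [h1, h2, if_true] using this
    push Not at htN
    obtain ⟨c, hc⟩ : ∃ c : Fin N, (c : ℕ) = t := ⟨⟨t, htN⟩, rfl⟩
    set p := repeatCount X c with hp
    set M : Matrix (Fin N) (Fin N) ℂ := Matrix.of fun (a b : Fin N) => if (a : ℕ) < t then
      iteratedDeriv (repeatCount X a) (f b) (X a) / (repeatCount X a).factorial else f b (X a)
      with hM
    -- Multiplicities of rows before `c` only look at earlier entries, so they do not change when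
    -- the entry at `c` moves.
    have hcount : ∀ u, ∀ a : Fin N, (a : ℕ) < t →
        repeatCount (Function.update X c u) a = repeatCount X a := by
      intro u a ha
      have hac : a ≠ c := fun h => by rw [h] at ha; omega
      unfold repeatCount
      congr 1
      refine Finset.filter_congr fun b hb => ?_
      have hbc : b ≠ c := fun h => by
        rw [h] at hb
        have := Fin.lt_def.1 (Finset.mem_Iio.1 hb)
        omega
      simp [hac, hbc]
    -- the row expansion
    have hrow : ∀ g : Fin N → ℂ, (M.updateRow c g).det = ∑ b, g b * M.adjugate b c := by
      intro g
      rw [Matrix.det_eq_sum_mul_adjugate_row _ c]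
      refine Finset.sum_congr rfl fun b _ => ?_
      rw [Matrix.updateRow_self, Matrix.adjugate_apply, Matrix.adjugate_apply,
        Matrix.updateRow_idem]
    set R : ℂ → ℂ := fun u => S (∑ a, Function.update X c u a) * (∏ a, h (Function.update X c u a))
      * ∏ a ∈ univ.erase c, ∏ b ∈ Iio a, if (a : ℕ) < t then
        leading θ (Function.update X c u a - Function.update X c u b)
        else θ (Function.update X c u a - Function.update X c u b) with hR
    -- The cofactors of row `c` do not involve that row, so the left side is a fixed combination of
    -- the `f b`. On the right `p` of the factors vanish at `X c`; the `p`-th derivative there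
    -- isolates the remaining factors.
    have hid : ∀ u ∈ U, ∑ b, f b u * M.adjugate b c = (∏ b ∈ Iio c, θ (u - X b)) * R u := by
      intro u hu
      rw [← hrow]
      have := ih (Function.update X c u) (fun a => by
        by_cases hac : a = c
        · subst hac; simpa using hu
        · simpa [hac] using hX a)
      have hm : (M.updateRow c fun b => f b u) = Matrix.of fun (a b : Fin N) => if (a : ℕ) < t then
          iteratedDeriv (repeatCount (Function.update X c u) a) (f b) (Function.update X c u a)
            / (repeatCount (Function.update X c u) a).factorial
          else f b (Function.update X c u a) := by
        ext a b
        by_cases hac : a = c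
        · subst hac
          simp [hc]
        · by_cases hat : (a : ℕ) < t
          · simp [hac, hat, hcount u a hat, hM]
          · simp [hac, hat, hM]
      have h3 : ∏ b ∈ Iio c, (if ((c : Fin N) : ℕ) < t then
          leading θ (Function.update X c u c - Function.update X c u b)
          else θ (Function.update X c u c - Function.update X c u b))
          = ∏ b ∈ Iio c, θ (u - X b) := by
        refine Finset.prod_congr rfl fun b hb => ?_
        have hbc : b ≠ c := (Finset.mem_Iio.1 hb).ne
        simp [hc, hbc]
      rw [hm, this, ← Finset.mul_prod_erase univ (fun a : Fin N => ∏ b ∈ Iio a, if (a : ℕ) < t then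
        leading θ (Function.update X c u a - Function.update X c u b)
        else θ (Function.update X c u a - Function.update X c u b)) (Finset.mem_univ c), h3]
      ring
    have hupd : ∀ a, Differentiable ℂ fun u => Function.update X c u a := by
      intro a
      by_cases hac : a = c
      · subst hac; simp
      · simp [hac]
    have hRan : AnalyticAt ℂ R (X c) := by
      have h1 : AnalyticAt ℂ (fun u => S (∑ a, Function.update X c u a)) (X c) :=
        (hS.comp (Differentiable.fun_sum fun a _ => hupd a)).analyticAt _
      have h2 : AnalyticAt ℂ (fun u => ∏ a, h (Function.update X c u a)) (X c) := by
        refine Finset.analyticAt_fun_prod _ fun a _ => ?_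
        refine AnalyticAt.fun_comp (f := fun u => Function.update X c u a) ?_
          ((hupd a).analyticAt _)
        simpa using hh _ (hX a)
      refine (h1.mul h2).mul (Finset.analyticAt_fun_prod _ fun a ha => ?_)
      refine Finset.analyticAt_fun_prod _ fun b hb => ?_
      by_cases hat : (a : ℕ) < t
      · have hac : a ≠ c := Finset.ne_of_mem_erase ha
        have hbc : b ≠ c := fun h => by
          rw [h] at hb
          have := Fin.lt_def.1 (Finset.mem_Iio.1 hb)
          omega
        simp only [hat, if_true, Function.update_of_ne hac, Function.update_of_ne hbc]
        exact analyticAt_const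
      · simp only [hat, if_false]
        exact (hθ.comp ((hupd a).sub (hupd b))).analyticAt _
    have hder : ∑ b, iteratedDeriv p (f b) (X c) * M.adjugate b c
        = p.factorial * ((∏ b ∈ Iio c, leading θ (X c - X b)) * R (X c)) := by
      rw [hp, repeatCount, ← iteratedDeriv_prod_mul (Iio c) X hθ hθ0 hRan]
      have he : (fun u => ∑ b, f b u * M.adjugate b c)
          =ᶠ[nhds (X c)] fun u => (∏ b ∈ Iio c, θ (u - X b)) * R u :=
        Filter.eventually_of_mem (hU.mem_nhds (hX c)) hid
      rw [← he.iteratedDeriv_eq, iteratedDeriv_fun_sum]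
      · refine Finset.sum_congr rfl fun b _ => ?_
        rw [iteratedDeriv_mul_const_field]
      · intro b _
        exact ((hf b _ (hX c)).mul analyticAt_const).contDiffAt
    have hlhs : (Matrix.of fun (a b : Fin N) => if (a : ℕ) < t + 1 then
        iteratedDeriv (repeatCount X a) (f b) (X a) / (repeatCount X a).factorial
        else f b (X a)) = M.updateRow c fun b => iteratedDeriv p (f b) (X c) / p.factorial := by
      ext a b
      by_cases hac : a = c
      · subst hac
        simp [hc, hp]
      · have : (a : ℕ) ≠ t := fun h => hac (Fin.ext (h.trans hc.symm))
        have h2 : (a : ℕ) < t + 1 ↔ (a : ℕ) < t := by omega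
        simp only [Matrix.of_apply, Matrix.updateRow_ne hac, hM, h2]
    rw [hlhs, hrow]
    have hpf : (p.factorial : ℂ) ≠ 0 := by exact_mod_cast p.factorial_ne_zero
    have : ∑ b, iteratedDeriv p (f b) (X c) / p.factorial * M.adjugate b c
        = (∏ b ∈ Iio c, leading θ (X c - X b)) * R (X c) := by
      rw [← mul_right_inj' hpf, ← hder, Finset.mul_sum]
      refine Finset.sum_congr rfl fun b _ => ?_
      field_simp
    rw [this, ← Finset.mul_prod_erase univ (fun a : Fin N => ∏ b ∈ Iio a, if (a : ℕ) < t + 1 then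
      leading θ (X a - X b) else θ (X a - X b)) (Finset.mem_univ c)]
    simp only [hR, Function.update_eq_self]
    have h3 : ∏ a ∈ univ.erase c, ∏ b ∈ Iio a, (if (a : ℕ) < t + 1 then
        leading θ (X a - X b) else θ (X a - X b))
        = ∏ a ∈ univ.erase c, ∏ b ∈ Iio a, (if (a : ℕ) < t then
        leading θ (X a - X b) else θ (X a - X b)) := by
      refine Finset.prod_congr rfl fun a ha => ?_
      have : (a : ℕ) ≠ t := fun h => Finset.ne_of_mem_erase ha (Fin.ext (h.trans hc.symm))
      have h2 : (a : ℕ) < t + 1 ↔ (a : ℕ) < t := by omega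
      simp only [h2]
    have h4 : ∏ b ∈ Iio c, (if ((c : Fin N) : ℕ) < t + 1 then
        leading θ (X c - X b) else θ (X c - X b)) = ∏ b ∈ Iio c, leading θ (X c - X b) := by
      simp [hc]
    rw [h3, h4]
    ring

/-! ### The Jacobi triple product. -/

/-- The finite product `(q; q)_m`. -/
def qPoch (q : ℂ) (m : ℕ) : ℂ := ∏ i ∈ range m, (1 - q ^ (i + 1))

/-- The reciprocal of `(q; q)_m`, extended by `0` to negative `m`. -/
def qPochInv (q : ℂ) (m : ℤ) : ℂ := if m < 0 then 0 else (qPoch q m.toNat)⁻¹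

lemma one_sub_pow_ne_zero {q : ℂ} (hq : ‖q‖ < 1) (n : ℕ) : 1 - q ^ (n + 1) ≠ 0 := by
  intro h
  have h1 : ‖q ^ (n + 1)‖ < 1 := by
    rw [norm_pow]; exact pow_lt_one₀ (norm_nonneg _) hq (Nat.succ_ne_zero n)
  rw [← sub_eq_zero.1 h] at h1
  simp at h1

/-- The value 0 at negative `m` is what makes the recurrence valid for all integers: at `m = 0` the
factor 1 - q⁰ vanishes. -/
lemma qPochInv_sub_one {q : ℂ} (hq : ‖q‖ < 1) (m : ℤ) :
    qPochInv q (m - 1) = (1 - q ^ m) * qPochInv q m := by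
  rcases lt_trichotomy m 0 with h | rfl | h
  · simp [qPochInv, h, show m - 1 < 0 by omega]
  · simp [qPochInv]
  · obtain ⟨n, rfl⟩ : ∃ n : ℕ, m = n + 1 := ⟨(m - 1).toNat, by omega⟩
    have h1 : ((n : ℤ) + 1).toNat = n + 1 := by omega
    have h2 : ¬ ((n : ℤ) + 1 < 0) := by omega
    have h3 := one_sub_pow_ne_zero hq n
    simp only [qPochInv, add_sub_cancel_right, h1, h2, if_false, Int.toNat_natCast,
      show ¬ ((n : ℤ) < 0) by omega, qPoch, prod_range_succ, mul_inv]
    rw [show ((n : ℤ) + 1) = ((n + 1 : ℕ) : ℤ) by push_cast; ring, zpow_natCast]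
    field_simp

/-- The `q`-binomial form of the finite triple product. -/
lemma hasSum_finite_triple {q w : ℂ} (hq : ‖q‖ < 1) (hq0 : q ≠ 0) (hw : w ≠ 0) {g : ℤ → ℂ}
    (g0 : g 0 = 1) (hg : ∀ k, g (k + 1) = -(q ^ (k + 1) * w) * g k) (n : ℕ) :
    HasSum (fun k : ℤ => g k * (qPoch q (2 * n) * qPochInv q (n + k) * qPochInv q (n - k)))
      (∏ i ∈ range n, ((1 - w * q ^ (i + 1)) * (1 - w⁻¹ * q ^ i))) := by
  -- The recurrence forces g(k) = (-1)^k q^(k(k+1)/2) w^k.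
  induction n with
  | zero =>
    convert! hasSum_single (0 : ℤ) (f := fun k : ℤ => g k *
      (qPoch q (2 * 0) * qPochInv q ((0 : ℕ) + k) * qPochInv q ((0 : ℕ) - k))) ?_ using 1
    · simp [g0, qPoch, qPochInv]
    · intro k hk
      rcases lt_or_gt_of_ne hk with h | h
      · simp [qPochInv, h]
      · simp [qPochInv, h]
  | succ n ih =>
    set a : ℤ → ℂ := fun k => g k * (qPoch q (2 * n) * qPochInv q (n + k) * qPochInv q (n - k))
      with ha
    set F := ∏ i ∈ range n, ((1 - w * q ^ (i + 1)) * (1 - w⁻¹ * q ^ i)) with hF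
    have hm : HasSum (fun k => a (k - 1)) F := by
      simpa using! (Equiv.subRight (1 : ℤ)).hasSum_iff.2 ih
    have hp : HasSum (fun k => a (k + 1)) F := by
      simpa using! (Equiv.addRight (1 : ℤ)).hasSum_iff.2 ih
    -- The new factor (1 - w q^(n+1))(1 - w⁻¹ qⁿ) expands to 1 + q^(2n+1) - w q^(n+1) - w⁻¹ qⁿ.
    -- Multiplication by it is matched with index shifts by ±1 in the sum.
    have key := ((ih.mul_left (1 + q ^ (2 * n + 1))).add (hm.mul_left (-(w * q ^ (n + 1))))).add
      (hp.mul_left (-(w⁻¹ * q ^ n)))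
    rw [prod_range_succ, ← hF]
    convert! key using 1
    · funext k
      simp only [ha]
      have e1 : qPochInv q ((n : ℤ) + k) = (1 - q ^ ((n : ℤ) + 1 + k)) * qPochInv q (n + 1 + k) := by
        rw [← qPochInv_sub_one hq]; congr 1; ring
      have e2 : qPochInv q ((n : ℤ) - k) = (1 - q ^ ((n : ℤ) + 1 - k)) * qPochInv q (n + 1 - k) := by
        rw [← qPochInv_sub_one hq]; congr 1; ring
      have e3 : qPochInv q ((n : ℤ) + (k - 1)) = (1 - q ^ ((n : ℤ) + k)) * qPochInv q (n + k) := by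
        rw [← qPochInv_sub_one hq]; congr 1; ring
      have e4 : qPochInv q ((n : ℤ) - (k + 1)) = (1 - q ^ ((n : ℤ) - k)) * qPochInv q (n - k) := by
        rw [← qPochInv_sub_one hq]; congr 1; ring
      have e5 : (n : ℤ) - (k - 1) = n + 1 - k := by ring
      have e6 : (n : ℤ) + (k + 1) = n + 1 + k := by ring
      have e7 : qPoch q (2 * (n + 1))
          = qPoch q (2 * n) * (1 - q ^ (2 * n + 1)) * (1 - q ^ (2 * n + 2)) := by
        simp only [qPoch, show 2 * (n + 1) = 2 * n + 1 + 1 by ring, prod_range_succ]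
      have g1 := hg (k - 1)
      rw [sub_add_cancel] at g1
      rw [hg k, g1, e3, e4, e5, e6, e1, e2, e7]
      push_cast
      have z1 : q ^ (k + 1) = q ^ k * q := by rw [zpow_add₀ hq0]; simp
      have z2 : q ^ ((n : ℤ) + 1 + k) = q ^ n * q * q ^ k := by
        rw [zpow_add₀ hq0, zpow_add₀ hq0]; simp
      have z3 : q ^ ((n : ℤ) + 1 - k) = q ^ n * q * (q ^ k)⁻¹ := by
        rw [zpow_sub₀ hq0, zpow_add₀ hq0]; simp [div_eq_mul_inv]
      have z4 : q ^ ((n : ℤ) + k) = q ^ n * q ^ k := by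
        rw [zpow_add₀ hq0]; simp
      have z5 : q ^ ((n : ℤ) - k) = q ^ n * (q ^ k)⁻¹ := by
        rw [zpow_sub₀ hq0]; simp [div_eq_mul_inv]
      have hk : q ^ k ≠ 0 := zpow_ne_zero _ hq0
      rw [z1, z2, z3, z4, z5]
      set v := q ^ k
      have z6 : q ^ (2 * n + 1) = (q ^ n) ^ 2 * q := by ring
      have z7 : q ^ (2 * n + 2) = (q ^ n) ^ 2 * q ^ 2 := by ring
      rw [z6, z7, pow_succ]
      set u := q ^ n
      field_simp
      ring
    · field_simp
      ring

lemma multipliable_one_sub_mul_pow {q : ℂ} (hq : ‖q‖ < 1) (c : ℂ) :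
    Multipliable fun n : ℕ => 1 - c * q ^ n := by
  have : Summable fun n : ℕ => ‖-(c * q ^ n)‖ := by
    simp only [norm_neg, norm_mul, norm_pow]
    exact (summable_geometric_of_lt_one (norm_nonneg _) hq).mul_left _
  simpa [sub_eq_add_neg] using multipliable_one_add_of_summable this

lemma tprod_one_sub_mul_pow_ne_zero {q : ℂ} (hq : ‖q‖ < 1) {c : ℂ}
    (h : ∀ n : ℕ, 1 - c * q ^ n ≠ 0) : ∏' n : ℕ, (1 - c * q ^ n) ≠ 0 := by
  have : Summable fun n : ℕ => ‖-(c * q ^ n)‖ := by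
    simp only [norm_neg, norm_mul, norm_pow]
    exact (summable_geometric_of_lt_one (norm_nonneg _) hq).mul_left _
  simpa [sub_eq_add_neg] using tprod_one_add_ne_zero_of_summable
    (f := fun n => -(c * q ^ n)) (fun n => by simpa [sub_eq_add_neg] using h n) this

/-- The Jacobi triple product identity. -/
theorem tsum_eq_triple_product {q w : ℂ} (hq : ‖q‖ < 1) (hq0 : q ≠ 0) (hw : w ≠ 0) {g : ℤ → ℂ}
    (g0 : g 0 = 1) (hg : ∀ k, g (k + 1) = -(q ^ (k + 1) * w) * g k)
    (hs : Summable fun k => ‖g k‖) :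
    ∑' k, g k = (∏' n : ℕ, (1 - q * q ^ n)) * (∏' n : ℕ, (1 - w * q * q ^ n)) *
      ∏' n : ℕ, (1 - w⁻¹ * q ^ n) := by
  set P := ∏' n : ℕ, (1 - q * q ^ n) with hP
  have hPne : P ≠ 0 := tprod_one_sub_mul_pow_ne_zero hq fun n => by
    simpa [pow_succ'] using one_sub_pow_ne_zero hq n
  have hPt : Tendsto (qPoch q) atTop (𝓝 P) := by
    have := (multipliable_one_sub_mul_pow hq q).hasProd.tendsto_prod_nat
    exact this.congr fun n => by simp only [qPoch, pow_succ']
  have hIt : Tendsto (fun n : ℕ => (qPoch q n)⁻¹) atTop (𝓝 P⁻¹) := hPt.inv₀ hPne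
  obtain ⟨A, hA⟩ := (Metric.isBounded_range_of_tendsto _ hPt).exists_norm_le
  obtain ⟨B, hB⟩ := (Metric.isBounded_range_of_tendsto _ hIt).exists_norm_le
  have hA' : ∀ n, ‖qPoch q n‖ ≤ A := fun n => hA _ ⟨n, rfl⟩
  have hA0 : 0 ≤ A := (norm_nonneg _).trans (hA' 0)
  have hB0 : 0 ≤ B := (norm_nonneg _).trans (hB _ ⟨0, rfl⟩)
  have hB' : ∀ m, ‖qPochInv q m‖ ≤ B := fun m => by
    unfold qPochInv
    split_ifs
    · simpa using hB0
    · exact hB _ ⟨m.toNat, rfl⟩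
  have hr : ∀ u : ℕ → ℤ, Tendsto u atTop atTop →
      Tendsto (fun n => qPochInv q (u n)) atTop (𝓝 P⁻¹) := by
    intro u hu
    have h1 : Tendsto (fun n => (u n).toNat) atTop atTop := by
      refine tendsto_atTop.2 fun b => ?_
      filter_upwards [hu.eventually_ge_atTop (b : ℤ)] with n hn
      omega
    refine (hIt.comp h1).congr' ?_
    filter_upwards [hu.eventually_ge_atTop 0] with n hn
    simp [qPochInv, not_lt.2 hn]
  have hcast : Tendsto (fun n : ℕ => (n : ℤ)) atTop atTop := tendsto_natCast_atTop_atTop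
  -- Dominated convergence as n → ∞: the q-factors are bounded uniformly by `A * B * B`, and each
  -- tends to its infinite product.
  have hlim : Tendsto (fun n : ℕ => ∑' k : ℤ, g k * (qPoch q (2 * n) * qPochInv q (n + k)
      * qPochInv q (n - k))) atTop (𝓝 (∑' k : ℤ, g k * (P * P⁻¹ * P⁻¹))) := by
    refine tendsto_tsum_of_dominated_convergence (bound := fun k => ‖g k‖ * (A * B * B))
      (hs.mul_right _) (fun k => ?_) (Eventually.of_forall fun n k => ?_)
    · refine Tendsto.const_mul _ ((Tendsto.mul ?_ ?_).mul ?_)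
      · exact hPt.comp (tendsto_id.const_mul_atTop' (by norm_num : 0 < 2))
      · exact hr _ (tendsto_atTop_add_const_right _ _ hcast)
      · simpa [sub_eq_add_neg] using hr _ (tendsto_atTop_add_const_right _ (-k) hcast)
    · rw [norm_mul, norm_mul, norm_mul]
      have := hA' (2 * n)
      have := hB' (n + k)
      have := hB' (n - k)
      gcongr
  simp only [(hasSum_finite_triple hq hq0 hw g0 hg _).tsum_eq, prod_mul_distrib] at hlim
  have h2 := (multipliable_one_sub_mul_pow hq (w * q)).hasProd.tendsto_prod_nat.mul
    (multipliable_one_sub_mul_pow hq w⁻¹).hasProd.tendsto_prod_nat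
  have h3 := tendsto_nhds_unique hlim (h2.congr fun n => by simp only [pow_succ', mul_assoc])
  rw [tsum_mul_right, mul_inv_cancel₀ hPne, one_mul] at h3
  rw [mul_assoc, ← h3]
  field_simp

/-! ### Theta series: quasi-periods, product formula, zeros, derivative at 0. -/

lemma summable_norm_exp_quadratic (τ : ℍ) (b : ℂ) :
    Summable fun n : ℤ => ‖Complex.exp (Complex.I * Real.pi * (n : ℂ) ^ 2 * τ + n * b)‖ := by
  have h := (summable_jacobiTheta₂_term_iff (b / (2 * Real.pi * Complex.I)) (τ : ℂ)).2 τ.im_pos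
  refine h.norm.congr fun n => ?_
  have := Complex.two_pi_I_ne_zero
  rw [jacobiTheta₂_term]
  congr 2
  field_simp
  ring

lemma theta_term_eq (a b : ℝ) (z : ℂ) (τ : ℍ) (n : ℤ) :
    Complex.exp (Complex.I * Real.pi * ((n : ℂ) + a) ^ 2 * (τ : ℂ)
      + ((n : ℂ) + a) * (z + 2 * Real.pi * Complex.I * b))
    = Complex.exp (Complex.I * Real.pi * a ^ 2 * τ + a * (z + 2 * Real.pi * Complex.I * b)) *
      Complex.exp (Complex.I * Real.pi * (n : ℂ) ^ 2 * τ
        + n * (2 * Real.pi * Complex.I * (a * τ + b) + z)) := by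
  rw [← Complex.exp_add]
  congr 1
  ring

lemma summable_norm_theta (a b : ℝ) (z : ℂ) (τ : ℍ) :
    Summable fun n : ℤ => ‖Complex.exp (Complex.I * Real.pi * ((n : ℂ) + a) ^ 2 * (τ : ℂ)
      + ((n : ℂ) + a) * (z + 2 * Real.pi * Complex.I * b))‖ := by
  simp_rw [theta_term_eq, norm_mul]
  exact (summable_norm_exp_quadratic τ _).mul_left _

lemma theta_eq_jacobiTheta₂ (a b : ℝ) (z : ℂ) (τ : ℍ) :
    theta a b z τ = Complex.exp (Complex.I * Real.pi * a ^ 2 * τ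
      + a * (z + 2 * Real.pi * Complex.I * b)) *
      jacobiTheta₂ (a * τ + b + z / (2 * Real.pi * Complex.I)) τ := by
  simp_rw [theta, theta_term_eq, tsum_mul_left, jacobiTheta₂, jacobiTheta₂_term]
  congr 1
  refine tsum_congr fun n => ?_
  have := Complex.two_pi_I_ne_zero
  congr 1
  field_simp
  ring

lemma differentiable_theta (a b : ℝ) (τ : ℍ) : Differentiable ℂ fun z => theta a b z τ := by
  intro z
  simp_rw [theta_eq_jacobiTheta₂]
  refine DifferentiableAt.mul (by fun_prop) ?_
  exact DifferentiableAt.comp (f := fun z : ℂ => (a : ℂ) * τ + b + z / (2 * Real.pi * Complex.I)) z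
    (differentiableAt_jacobiTheta₂_fst _ τ.im_pos) (by fun_prop)

lemma theta_add_two_pi_I (a b : ℝ) (z : ℂ) (τ : ℍ) :
    theta a b (z + 2 * Real.pi * Complex.I) τ
      = Complex.exp (2 * Real.pi * Complex.I * a) * theta a b z τ := by
  rw [theta, theta, ← tsum_mul_left]
  refine tsum_congr fun n => ?_
  rw [← Complex.exp_add, Complex.exp_eq_exp_iff_exists_int]
  exact ⟨n, by ring⟩

lemma theta_add_two_pi_I_mul (a b : ℝ) (z : ℂ) (τ : ℍ) :
    theta a b (z + 2 * Real.pi * Complex.I * τ) τ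
      = Complex.exp (-(Complex.I * Real.pi * τ) - z - 2 * Real.pi * Complex.I * b)
        * theta a b z τ := by
  rw [theta, theta, ← tsum_mul_left, ← (Equiv.subRight (1 : ℤ)).tsum_eq]
  refine tsum_congr fun n => ?_
  rw [← Complex.exp_add]
  congr 1
  simp only [Equiv.subRight_apply]
  push_cast
  ring

/-- Changing the characteristics amounts to translating z by 2πi(α - βτ), so everything about the
general theta series reduces to ϑ₁. -/
lemma theta_shift (α β : ℝ) (z : ℂ) (τ : ℍ) :
    theta (1 / 2 - β) (1 / 2 + α) z τ
      = Complex.exp (Complex.I * Real.pi * β ^ 2 * τ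
          - β * (z + Real.pi * Complex.I + 2 * Real.pi * Complex.I * α)) *
        theta (1 / 2) (1 / 2) (z + 2 * Real.pi * Complex.I * (α - β * τ)) τ := by
  rw [theta, theta, ← tsum_mul_left]
  refine tsum_congr fun n => ?_
  rw [← Complex.exp_add]
  congr 1
  push_cast
  ring

/-- The reindexing n ↦ -1 - n negates n + ½, and the characteristic b = ½ then contributes
exp(-πi(2n + 1)) = -1. -/
lemma theta_half_neg (z : ℂ) (τ : ℍ) :
    theta (1 / 2) (1 / 2) (-z) τ = -theta (1 / 2) (1 / 2) z τ := by
  rw [theta, theta, ← tsum_neg, ← (Equiv.subLeft (-1 : ℤ)).tsum_eq]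
  refine tsum_congr fun n => ?_
  rw [neg_eq_neg_one_mul (Complex.exp _), ← Complex.exp_pi_mul_I, ← Complex.exp_add, Complex.exp_eq_exp_iff_exists_int]
  refine ⟨-n - 1, ?_⟩
  simp only [Equiv.subLeft_apply]
  push_cast
  ring

lemma theta_half_zero (τ : ℍ) : theta (1 / 2) (1 / 2) 0 τ = 0 := by
  have := theta_half_neg 0 τ
  rw [neg_zero] at this
  exact self_eq_neg.1 this

/-- The product `∏ (1 - qⁿ) (1 - eᶻ qⁿ) (1 - e⁻ᶻ qⁿ)` over `n ≥ 1`. -/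
def tripleProd (q z : ℂ) : ℂ :=
  (∏' n : ℕ, (1 - q * q ^ n)) * (∏' n : ℕ, (1 - Complex.exp z * q * q ^ n)) *
    ∏' n : ℕ, (1 - Complex.exp (-z) * q * q ^ n)

/-- The nome squared, `q = exp (2πiτ)`. -/
def nome (τ : ℍ) : ℂ := Complex.exp (2 * Real.pi * Complex.I * τ)

lemma norm_nome_lt_one (τ : ℍ) : ‖nome τ‖ < 1 := norm_exp_two_pi_I_lt_one τ

lemma nome_ne_zero (τ : ℍ) : nome τ ≠ 0 := Complex.exp_ne_zero _

/-- Triple product with w = eᶻ. The n = 0 factor 1 - e⁻ᶻ is split off because it alone carries the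
zero at z = 0. -/
lemma theta_half_eq_tripleProd (z : ℂ) (τ : ℍ) :
    theta (1 / 2) (1 / 2) z τ = Complex.exp (Complex.I * Real.pi * τ / 4 + Real.pi * Complex.I / 2)
      * Complex.exp (z / 2) * (1 - Complex.exp (-z)) * tripleProd (nome τ) z := by
  have hq := norm_nome_lt_one τ
  set g : ℤ → ℂ := fun n => Complex.exp (Complex.I * Real.pi * τ * (n * (n + 1))
    + n * (z + Real.pi * Complex.I)) with hg
  have hth : ∀ n : ℤ, Complex.exp (Complex.I * Real.pi * ((n : ℂ) + (1 / 2 : ℝ)) ^ 2 * (τ : ℂ)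
      + ((n : ℂ) + (1 / 2 : ℝ)) * (z + 2 * Real.pi * Complex.I * (1 / 2 : ℝ)))
      = Complex.exp (Complex.I * Real.pi * τ / 4 + Real.pi * Complex.I / 2)
      * Complex.exp (z / 2) * g n := by
    intro n
    rw [hg, ← Complex.exp_add, ← Complex.exp_add]
    congr 1
    push_cast
    ring
  have hs : Summable fun n => ‖g n‖ := by
    refine (summable_norm_exp_quadratic τ (Complex.I * Real.pi * τ + z + Real.pi * Complex.I)).congr
      fun n => ?_
    rw [hg]
    congr 2
    ring
  have h0 : g 0 = 1 := by simp [hg]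
  have hrec : ∀ k, g (k + 1) = -(nome τ ^ (k + 1) * Complex.exp z) * g k := by
    intro k
    simp only [hg, nome]
    rw [← Complex.exp_int_mul, ← Complex.exp_add, neg_eq_neg_one_mul (Complex.exp _),
      ← Complex.exp_pi_mul_I, ← Complex.exp_add, ← Complex.exp_add]
    congr 1
    push_cast
    ring
  rw [theta]
  simp_rw [hth]
  rw [tsum_mul_left, tsum_eq_triple_product hq (nome_ne_zero τ) (Complex.exp_ne_zero z) h0 hrec hs,
    tprod_eq_zero_mul' (f := fun n : ℕ => 1 - (Complex.exp z)⁻¹ * nome τ ^ n) ?_,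
    tripleProd, Complex.exp_neg]
  · simp only [pow_zero, mul_one, pow_succ', ← mul_assoc]
    ring
  · simpa only [pow_succ', mul_assoc] using
      multipliable_one_sub_mul_pow hq ((Complex.exp z)⁻¹ * nome τ)

lemma tripleProd_ne_zero {z : ℂ} {τ : ℍ} (hz : ∀ n : ℤ, n ≠ 0 →
    Complex.exp z * nome τ ^ n ≠ 1) : tripleProd (nome τ) z ≠ 0 := by
  have hq := norm_nome_lt_one τ
  refine mul_ne_zero (mul_ne_zero ?_ ?_) ?_ <;> refine tprod_one_sub_mul_pow_ne_zero hq fun n => ?_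
  · simpa [pow_succ'] using one_sub_pow_ne_zero hq n
  · have := hz (n + 1) (by omega)
    rw [show ((n : ℤ) + 1) = ((n + 1 : ℕ) : ℤ) by push_cast; ring, zpow_natCast, pow_succ',
      ← mul_assoc] at this
    exact sub_ne_zero.2 this.symm
  · have := hz (-(n + 1)) (by omega)
    rw [show (-((n : ℤ) + 1)) = -((n + 1 : ℕ) : ℤ) by push_cast; ring, zpow_neg, zpow_natCast,
      pow_succ'] at this
    refine sub_ne_zero.2 fun h => this ?_
    have h2 := congrArg (·⁻¹) h
    simp only [mul_inv, Complex.exp_neg, inv_inv, inv_one] at h2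
    rw [h2, mul_inv, mul_assoc]

lemma differentiable_tprod_one_sub_mul_pow {q : ℂ} (hq : ‖q‖ < 1) :
    Differentiable ℂ fun c : ℂ => ∏' n : ℕ, (1 - c * q ^ n) := by
  intro c
  have hu : Summable fun n : ℕ => (‖c‖ + 1) * ‖q‖ ^ n :=
    (summable_geometric_of_lt_one (norm_nonneg _) hq).mul_left _
  have h := hu.hasProdLocallyUniformlyOn_nat_one_add (f := fun n (c : ℂ) => -(c * q ^ n))
    (K := Metric.ball 0 (‖c‖ + 1)) Metric.isOpen_ball
    (Eventually.of_forall fun n x hx => by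
      rw [norm_neg, norm_mul, norm_pow]
      gcongr
      simpa using (Metric.mem_ball.1 hx).le) (fun n => by fun_prop)
  have h2 : DifferentiableOn ℂ (fun c : ℂ => ∏' n : ℕ, (1 + -(c * q ^ n)))
      (Metric.ball 0 (‖c‖ + 1)) :=
    h.tendstoLocallyUniformlyOn_finsetRange.differentiableOn
      (Eventually.of_forall fun n => by fun_prop) Metric.isOpen_ball
  simpa [sub_eq_add_neg] using h2.differentiableAt (Metric.isOpen_ball.mem_nhds (by simp))

lemma differentiable_tripleProd {q : ℂ} (hq : ‖q‖ < 1) : Differentiable ℂ (tripleProd q) := by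
  have h := differentiable_tprod_one_sub_mul_pow hq
  refine ((differentiable_const _).mul ?_).mul ?_
  · exact h.comp (f := fun z => Complex.exp z * q) (by fun_prop)
  · exact h.comp (f := fun z => Complex.exp (-z) * q) (by fun_prop)

lemma tripleProd_add_two_pi_I (q z : ℂ) :
    tripleProd q (z + 2 * Real.pi * Complex.I) = tripleProd q z := by
  rw [tripleProd, tripleProd, neg_add, Complex.exp_add, Complex.exp_add, Complex.exp_neg (2 * _ * _),
    Complex.exp_two_pi_mul_I]
  simp

lemma mem_lattice_of_exp_eq {z : ℂ} {τ : ℍ} {n : ℤ} (h : Complex.exp z * nome τ ^ n = 1) :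
    z ∈ lattice τ := by
  rw [nome, ← Complex.exp_int_mul, ← Complex.exp_add, Complex.exp_eq_one_iff] at h
  obtain ⟨k, hk⟩ := h
  exact ⟨-n, k, by push_cast; linear_combination hk⟩

lemma theta_half_ne_zero {z : ℂ} {τ : ℍ} (hz : z ∉ lattice τ) : theta (1 / 2) (1 / 2) z τ ≠ 0 := by
  rw [theta_half_eq_tripleProd]
  refine mul_ne_zero (mul_ne_zero (mul_ne_zero (Complex.exp_ne_zero _) (Complex.exp_ne_zero _)) ?_)
    (tripleProd_ne_zero fun n _ h => hz (mem_lattice_of_exp_eq h))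
  refine sub_ne_zero.2 fun h => hz (mem_lattice_of_exp_eq (n := 0) ?_)
  rw [Complex.exp_neg] at h
  simpa using (inv_eq_one.1 h.symm)

/-- At z = 2πi(aτ + b) one has eᶻ = q^a, which kills a factor in eᶻ if a < 0, in e⁻ᶻ if a > 0, and 1
- e⁻ᶻ if a = 0. The equivalence later shows that the zeros are countable and that the complement of
the lattice is open. -/
lemma theta_half_eq_zero_iff {z : ℂ} {τ : ℍ} :
    theta (1 / 2) (1 / 2) z τ = 0 ↔ z ∈ lattice τ := by
  refine ⟨fun h => by_contra fun hz => theta_half_ne_zero hz h, ?_⟩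
  rintro ⟨a, b, rfl⟩
  set z := 2 * Real.pi * Complex.I * (a * (τ : ℂ) + b) with hz
  have h1 : Complex.exp z = nome τ ^ a := by
    rw [nome, ← Complex.exp_int_mul, Complex.exp_eq_exp_iff_exists_int]
    exact ⟨b, by rw [hz]; ring⟩
  have hq := nome_ne_zero τ
  rw [theta_half_eq_tripleProd, tripleProd, Complex.exp_neg, h1]
  rcases lt_trichotomy a 0 with h | rfl | h
  · obtain ⟨n, rfl⟩ : ∃ n : ℕ, a = -(n + 1 : ℕ) := ⟨(-a - 1).toNat, by omega⟩
    have : ∃ k : ℕ, 1 - nome τ ^ (-((n + 1 : ℕ) : ℤ)) * nome τ * nome τ ^ k = 0 :=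
      ⟨n, by rw [zpow_neg, zpow_natCast]; field_simp; ring⟩
    rw [tprod_of_exists_eq_zero this]; ring
  · simp
  · obtain ⟨n, rfl⟩ : ∃ n : ℕ, a = (n + 1 : ℕ) := ⟨(a - 1).toNat, by omega⟩
    have : ∃ k : ℕ, 1 - (nome τ ^ ((n + 1 : ℕ) : ℤ))⁻¹ * nome τ * nome τ ^ k = 0 :=
      ⟨n, by rw [zpow_natCast]; field_simp; ring⟩
    rw [tprod_of_exists_eq_zero this]; ring

/-- Only 1 - e⁻ᶻ needs differentiating; at z = 0 the three products in `tripleProd` coincide, giving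
∏(1 - qⁿ)³, and the prefactor is i q^(1/8). -/
lemma deriv_theta_half_zero (τ : ℍ) :
    deriv (fun z => theta (1 / 2) (1 / 2) z τ) 0 = Complex.I * ModularForm.eta τ ^ 3 := by
  have h1 : HasDerivAt (fun z : ℂ => 1 - Complex.exp (-z)) 1 0 := by
    simpa using! ((hasDerivAt_neg (0 : ℂ)).cexp).const_sub 1
  set C := Complex.exp (Complex.I * Real.pi * τ / 4 + Real.pi * Complex.I / 2)
  set G : ℂ → ℂ := fun z => C * Complex.exp (z / 2) * tripleProd (nome τ) z with hG
  have hGc : ContinuousAt G 0 := by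
    have := (differentiable_tripleProd (norm_nome_lt_one τ)).continuous
    exact Continuous.continuousAt (by fun_prop)
  have h2 : HasDerivAt (fun z => theta (1 / 2) (1 / 2) z τ) (G 0) 0 := by
    rw [hasDerivAt_iff_tendsto_slope] at h1 ⊢
    have h3 := h1.mul (hGc.tendsto.mono_left nhdsWithin_le_nhds)
    rw [one_mul] at h3
    refine h3.congr fun z => ?_
    simp only [slope_def_field, theta_half_eq_tripleProd, hG]
    simp
    ring
  rw [h2.deriv, hG]
  have h4 : ModularForm.eta (τ : ℂ) = Complex.exp (2 * Real.pi * Complex.I * τ / 24) *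
      ∏' n : ℕ, (1 - nome τ * nome τ ^ n) := by
    simp [ModularForm.eta, Function.Periodic.qParam, nome, pow_succ']
  rw [h4, mul_pow, ← Complex.exp_nat_mul]
  have h5 : C = Complex.I * Complex.exp ((3 : ℕ) * (2 * Real.pi * Complex.I * τ / 24)) := by
    change Complex.exp (Complex.I * Real.pi * τ / 4 + Real.pi * Complex.I / 2) = _
    rw [show ∀ A, Complex.I * Complex.exp A = Complex.exp (Real.pi / 2 * Complex.I) * Complex.exp A
      from fun A => by rw [Complex.exp_pi_div_two_mul_I], ← Complex.exp_add]
    congr 1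
    push_cast
    ring
  simp only [h5, tripleProd]
  simp
  ring

/-! ### The three-term relation and the Frobenius determinant. -/

/-- In the double series over (k, l), x is multiplied by k + l + 1 and y by k - l, which have
opposite parities. Splitting by parity separates the variables; `A` and `B` sum over even and odd
frequencies. -/
lemma theta_half_add_mul_theta_half_sub (τ : ℍ) : ∃ A B : ℂ → ℂ, ∀ x y,
    theta (1 / 2) (1 / 2) (x + y) τ * theta (1 / 2) (1 / 2) (x - y) τ = A x * B y - B x * A y := by
  set E : ℂ → ℂ → ℂ := fun x s => Complex.exp (Complex.I * Real.pi * τ * s ^ 2 / 2 + s * x) with hE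
  refine ⟨fun x => ∑' i : ℤ, E x (2 * i), fun x => ∑' i : ℤ, E x (2 * i + 1), fun x y => ?_⟩
  -- The even and odd subseries are theta series at 2τ; this point serves only for their
  -- summability.
  set τ' : ℍ := ⟨2 * τ, by simpa using τ.im_pos⟩
  have hτ' : (τ' : ℂ) = 2 * τ := rfl
  have sA : ∀ x, Summable fun i : ℤ => ‖E x (2 * i)‖ := fun x => by
    refine (summable_norm_exp_quadratic τ' (2 * x)).congr fun n => ?_
    rw [hE, hτ']
    congr 2
    ring
  have sB : ∀ x, Summable fun i : ℤ => ‖E x (2 * i + 1)‖ := fun x => by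
    refine ((summable_norm_exp_quadratic τ' (2 * x + Complex.I * Real.pi * τ * 2)).mul_left
      ‖Complex.exp (Complex.I * Real.pi * τ / 2 + x)‖).congr fun n => ?_
    rw [hE, hτ', ← norm_mul, ← Complex.exp_add]
    congr 2
    ring
  let e : (ℤ × ℤ) ⊕ (ℤ × ℤ) → ℤ × ℤ :=
    Sum.elim (fun p => (p.1 + p.2, p.1 - p.2 - 1)) (fun p => (p.1 + p.2, p.1 - p.2))
  have he : Function.Bijective e := by
    constructor
    · rintro (⟨a, b⟩ | ⟨a, b⟩) (⟨c, d⟩ | ⟨c, d⟩) h <;>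
        simp only [e, Sum.elim_inl, Sum.elim_inr, Prod.mk.injEq] at h <;>
        simp <;> omega
    · rintro ⟨k, l⟩
      rcases Int.even_or_odd' (k - l) with ⟨c, hc | hc⟩
      · exact ⟨Sum.inr (k - c, c), by simp [e]; omega⟩
      · exact ⟨Sum.inl (k - c, c), by simp [e]; omega⟩
  have hAB := (summable_mul_of_summable_norm (sA x) (sB y)).hasSum
  rw [← tsum_mul_tsum_of_summable_norm (sA x) (sB y)] at hAB
  have hBA := ((summable_mul_of_summable_norm (sB x) (sA y)).hasSum).neg
  rw [← tsum_mul_tsum_of_summable_norm (sB x) (sA y)] at hBA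
  have sT := fun z => summable_norm_theta (1 / 2) (1 / 2) z τ
  rw [theta, theta, tsum_mul_tsum_of_summable_norm (sT _) (sT _),
    ← (Equiv.ofBijective e he).tsum_eq, sub_eq_add_neg]
  have key : HasSum (Sum.elim (fun p : ℤ × ℤ => E x (2 * p.1) * E y (2 * p.2 + 1))
    fun p : ℤ × ℤ => -(E x (2 * p.1 + 1) * E y (2 * p.2))) _ := HasSum.sum hAB hBA
  refine (tsum_congr fun p => ?_).trans key.tsum_eq
  rcases p with ⟨i, j⟩ | ⟨i, j⟩
  · simp only [Equiv.ofBijective_apply, e, Sum.elim_inl, hE]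
    rw [← Complex.exp_add, ← Complex.exp_add, Complex.exp_eq_exp_iff_exists_int]
    refine ⟨i, ?_⟩
    push_cast
    ring
  · simp only [Equiv.ofBijective_apply, e, Sum.elim_inr, hE]
    rw [← Complex.exp_add, ← Complex.exp_add, neg_eq_neg_one_mul (Complex.exp _),
      ← Complex.exp_pi_mul_I, ← Complex.exp_add, Complex.exp_eq_exp_iff_exists_int]
    refine ⟨i, ?_⟩
    push_cast
    ring

/-- Each product ϑ₁(p + q)ϑ₁(p - q) is a 2 × 2 minor in the vectors (A, B) at p and q, so the
relation is the Plücker relation for the four vectors at a, b, c, d below. -/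
lemma theta_half_three_term (τ : ℍ) (t x x' y y' : ℂ) :
    theta (1 / 2) (1 / 2) (x' - y' + t) τ * theta (1 / 2) (1 / 2) (x - y + t) τ *
        (theta (1 / 2) (1 / 2) (x - y') τ * theta (1 / 2) (1 / 2) (x' - y) τ) -
      theta (1 / 2) (1 / 2) (x - y' + t) τ * theta (1 / 2) (1 / 2) (x' - y + t) τ *
        (theta (1 / 2) (1 / 2) (x' - y') τ * theta (1 / 2) (1 / 2) (x - y) τ) =
      theta (1 / 2) (1 / 2) t τ * theta (1 / 2) (1 / 2) (t + x' - y' + (x - y)) τ *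
        (theta (1 / 2) (1 / 2) (x - x') τ * theta (1 / 2) (1 / 2) (y' - y) τ) := by
  obtain ⟨A, B, h⟩ := theta_half_add_mul_theta_half_sub τ
  set a := t + (x' - y' + x - y) / 2
  set b := (x' - y' - x + y) / 2
  set c := (x + x' - y - y') / 2
  set d := (x - x' - y' + y) / 2
  have h1 : a + b = x' - y' + t := by ring
  have h2 : a - b = x - y + t := by ring
  have h3 : c + d = x - y' := by ring
  have h4 : c - d = x' - y := by ring
  have h5 : a + d = x - y' + t := by ring
  have h6 : a - d = x' - y + t := by ring
  have h7 : b + c = x' - y' := by ring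
  have h8 : b - c = -(x - y) := by ring
  have h9 : a + c = t + x' - y' + (x - y) := by ring
  have h10 : a - c = t := by ring
  have h11 : b + d = -(y' - y) := by ring
  have h12 : b - d = -(x - x') := by ring
  have k1 := h a b
  have k2 := h c d
  have k3 := h a d
  have k4 := h b c
  have k5 := h a c
  have k6 := h b d
  rw [h1, h2] at k1
  rw [h3, h4] at k2
  rw [h5, h6] at k3
  rw [h7, h8, theta_half_neg] at k4
  rw [h9, h10] at k5
  rw [h11, h12, theta_half_neg, theta_half_neg] at k6
  have k4' : theta (1 / 2) (1 / 2) (x' - y') τ * theta (1 / 2) (1 / 2) (x - y) τ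
      = -(A b * B c - B b * A c) := by linear_combination -k4
  have k5' : theta (1 / 2) (1 / 2) t τ * theta (1 / 2) (1 / 2) (t + x' - y' + (x - y)) τ
      = A a * B c - B a * A c := by linear_combination k5
  have k6' : theta (1 / 2) (1 / 2) (x - x') τ * theta (1 / 2) (1 / 2) (y' - y) τ
      = A b * B d - B b * A d := by linear_combination k6
  rw [k1, k2, k3, k4', k5', k6']
  ring

lemma prod_Iio_succ {N : ℕ} (a : Fin N) (f : Fin (N + 1) → ℂ) :
    ∏ b ∈ Iio a.succ, f b = f 0 * ∏ b ∈ Iio a, f b.succ := by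
  have h : ∀ {n : ℕ} (c : Fin n) (g : Fin n → ℂ),
      ∏ b ∈ Iio c, g b = ∏ b, if b < c then g b else 1 := by
    intro n c g
    rw [← Finset.prod_filter]
    congr 1
    ext b
    simp
  rw [h, h, Fin.prod_univ_succ]
  simp

/-- Schur complement with respect to the top left entry. -/
lemma det_succ_eq_mul_det_schur {N : ℕ} (M : Matrix (Fin (N + 1)) (Fin (N + 1)) ℂ)
    (h : M 0 0 ≠ 0) : M.det = M 0 0 * (Matrix.of fun i j : Fin N =>
      M i.succ j.succ - M i.succ 0 * M 0 j.succ / M 0 0).det := by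
  set B : Matrix (Fin (N + 1)) (Fin (N + 1)) ℂ :=
    Matrix.of fun i j => if i = 0 then M 0 j else M i j - M i 0 / M 0 0 * M 0 j with hB
  rw [Matrix.det_eq_of_forall_row_eq_smul_add_const (A := M) (B := B)
    (fun i => if i = 0 then 0 else M i 0 / M 0 0) 0 (by simp) ?_]
  · rw [Matrix.det_succ_column_zero, Fin.sum_univ_succ, Finset.sum_eq_zero, add_zero]
    · simp only [hB, Matrix.of_apply, if_true, Fin.val_zero, pow_zero, one_mul]
      congr 2
      ext i j
      simp [Fin.succ_ne_zero]
      ring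
    · intro i _
      simp [hB, Fin.succ_ne_zero, h]
  · intro i j
    by_cases hi : i = 0
    · simp [hB, hi]
    · simp [hB, hi]

/-- The Frobenius determinant for a function with a three-term relation. -/
theorem frobenius_det {θ : ℂ → ℂ} (hθ : Continuous θ) (hz : {z | θ z = 0}.Countable)
    (three : ∀ t x x' y y', θ (x' - y' + t) * θ (x - y + t) * (θ (x - y') * θ (x' - y)) -
      θ (x - y' + t) * θ (x' - y + t) * (θ (x' - y') * θ (x - y)) =
      θ t * θ (t + x' - y' + (x - y)) * (θ (x - x') * θ (y' - y)))
    {N : ℕ} (u v : Fin N → ℂ) (huv : ∀ i j, θ (u i - v j) ≠ 0) {t : ℂ} (ht : θ t ≠ 0) :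
    (Matrix.of fun i j => θ (u i - v j + t) / (θ t * θ (u i - v j))).det
      = θ (t + (∑ i, u i - ∑ j, v j)) / θ t *
        ((∏ a, ∏ b ∈ Iio a, θ (u a - u b)) * ∏ a, ∏ b ∈ Iio a, θ (v b - v a)) /
          ∏ i, ∏ j, θ (u i - v j) := by
  induction N generalizing t with
  | zero => simp [ht]
  | succ N ih =>
    set c := u 0 - v 0 with hc
    have hcne : θ c ≠ 0 := huv 0 0
    -- the generic case
    have generic : ∀ t, θ t ≠ 0 → θ (t + c) ≠ 0 →
        (Matrix.of fun i j => θ (u i - v j + t) / (θ t * θ (u i - v j))).det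
        = θ (t + (∑ i, u i - ∑ j, v j)) / θ t *
        ((∏ a, ∏ b ∈ Iio a, θ (u a - u b)) * ∏ a, ∏ b ∈ Iio a, θ (v b - v a)) /
          ∏ i, ∏ j, θ (u i - v j) := by
      intro t ht htc
      have htc' : θ (c + t) ≠ 0 := by rwa [add_comm]
      rw [det_succ_eq_mul_det_schur _ (by
        simpa [← hc] using div_ne_zero htc' (mul_ne_zero ht hcne))]
      -- By the three-term relation the Schur complement is again a Frobenius matrix, with parameter
      -- t + c, up to scalings of rows and columns.
      have hent : (Matrix.of fun i j : Fin N =>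
          (Matrix.of fun i j => θ (u i - v j + t) / (θ t * θ (u i - v j))) i.succ j.succ
          - (Matrix.of fun i j => θ (u i - v j + t) / (θ t * θ (u i - v j))) i.succ 0
          * (Matrix.of fun i j => θ (u i - v j + t) / (θ t * θ (u i - v j))) 0 j.succ
          / (Matrix.of fun i j => θ (u i - v j + t) / (θ t * θ (u i - v j))) 0 0)
          = Matrix.of fun i j : Fin N => (θ (u i.succ - u 0) / θ (u i.succ - v 0)) *
            (Matrix.of fun i j : Fin N => (θ (v 0 - v j.succ) / θ (u 0 - v j.succ)) *
              (Matrix.of fun i j : Fin N => θ (u i.succ - v j.succ + (t + c)) /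
              (θ (t + c) * θ (u i.succ - v j.succ))) i j) i j := by
        ext i j
        simp only [Matrix.of_apply]
        have h3 := three t (u i.succ) (u 0) (v j.succ) (v 0)
        have e1 := huv i.succ j.succ
        have e2 := huv i.succ 0
        have e3 := huv 0 j.succ
        rw [← hc, show t + u 0 - v 0 + (u i.succ - v j.succ) = u i.succ - v j.succ + (t + c) by
          rw [hc]; ring] at h3
        rw [← hc]
        rw [add_comm c t] at h3 ⊢
        field_simp
        linear_combination h3
      rw [hent, Matrix.det_mul_column, Matrix.det_mul_row,
        ih (fun i => u i.succ) (fun j => v j.succ) (fun i j => huv _ _) htc]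
      simp only [Matrix.of_apply, ← hc, Fin.prod_univ_succ, Fin.sum_univ_succ, prod_Iio_succ,
        Finset.prod_mul_distrib, Finset.prod_div_distrib]
      have e1 : (∏ i : Fin N, θ (u i.succ - v 0)) ≠ 0 := prod_ne_zero_iff.2 fun i _ => huv _ _
      have e2 : (∏ j : Fin N, θ (u 0 - v j.succ)) ≠ 0 := prod_ne_zero_iff.2 fun i _ => huv _ _
      have e3 : (∏ i : Fin N, ∏ j : Fin N, θ (u i.succ - v j.succ)) ≠ 0 :=
        prod_ne_zero_iff.2 fun i _ => prod_ne_zero_iff.2 fun j _ => huv _ _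
      have e4 : Iio (0 : Fin (N + 1)) = ∅ := by ext b; simp
      rw [show t + (u 0 + ∑ i : Fin N, u i.succ - (v 0 + ∑ j : Fin N, v j.succ))
        = t + c + (∑ i : Fin N, u i.succ - ∑ j : Fin N, v j.succ) by rw [hc]; ring, e4,
        add_comm c t]
      simp only [Finset.prod_empty, one_mul]
      field_simp
    -- density
    have hd : Dense ({z | θ z = 0} ∪ {z | θ (z + c) = 0})ᶜ := by
      refine Set.Countable.dense_compl ℂ (hz.union ?_)
      exact hz.preimage (add_left_injective c)
    have hne : (𝓝[({z | θ z = 0} ∪ {z | θ (z + c) = 0})ᶜ] t).NeBot :=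
      mem_closure_iff_nhdsWithin_neBot.1 (hd t)
    have hL : ContinuousAt (fun t => (Matrix.of fun i j =>
        θ (u i - v j + t) / (θ t * θ (u i - v j))).det) t := by
      refine ContinuousAt.comp (g := Matrix.det) (Continuous.matrix_det continuous_id).continuousAt ?_
      refine continuousAt_pi.2 fun i => continuousAt_pi.2 fun j => ?_
      have h0 := huv i j
      refine ContinuousAt.div₀ ?_ ?_ (mul_ne_zero ht h0) <;>
        exact Continuous.continuousAt (by fun_prop)
    have hR : ContinuousAt (fun t => θ (t + (∑ i, u i - ∑ j, v j)) / θ t *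
        ((∏ a, ∏ b ∈ Iio a, θ (u a - u b)) * ∏ a, ∏ b ∈ Iio a, θ (v b - v a)) /
          ∏ i, ∏ j, θ (u i - v j)) t := by
      refine ContinuousAt.div_const (ContinuousAt.mul (ContinuousAt.div₀ ?_ ?_ ht)
        continuousAt_const) _ <;> exact Continuous.continuousAt (by fun_prop)
    refine tendsto_nhds_unique_of_eventuallyEq
      (l := 𝓝[({z | θ z = 0} ∪ {z | θ (z + c) = 0})ᶜ] t) (hL.tendsto.mono_left nhdsWithin_le_nhds)
      (hR.tendsto.mono_left nhdsWithin_le_nhds) ?_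
    filter_upwards [self_mem_nhdsWithin] with s hs
    simp only [Set.mem_compl_iff, Set.mem_union, Set.mem_ofPred_eq, not_or] at hs
    exact generic s hs.1 hs.2

/-! ### The deformed series and its continuation across Re z = 0. -/

/-- The width `2π Im τ` of the strip on which the deformed series converges. -/
def width (τ : ℍ) : ℝ := 2 * Real.pi * τ.im

lemma width_pos (τ : ℍ) : 0 < width τ := by
  have := τ.im_pos
  have := Real.pi_pos
  unfold width
  positivity

/-- The power `q ^ (k + l)`. -/
def nomePow (l : ℝ) (τ : ℍ) (k : ℤ) : ℂ :=
  Complex.exp (2 * Real.pi * Complex.I * (τ : ℂ) * ((k : ℂ) + l))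

/-- The coefficient of `exp ((k + l) z)` in the deformed series. -/
def seriesCoeff (a : ℂ) (l : ℝ) (τ : ℍ) (k : ℤ) : ℂ := -(1 / (1 - a * nomePow l τ k))

/-- The coefficients of the deformed series after removal of a geometric series. -/
def regCoeff (a : ℂ) (l : ℝ) (τ : ℍ) (k : ℤ) : ℂ :=
  seriesCoeff a l τ k + if 0 ≤ k then 1 else 0

/-- The part of the deformed series that is holomorphic on the doubled strip. -/
def regSeries (a : ℂ) (l : ℝ) (τ : ℍ) (z : ℂ) : ℂ :=
  ∑' k : ℤ, regCoeff a l τ k * Complex.exp (((k : ℂ) + l) * z)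

lemma norm_nomePow (l : ℝ) (τ : ℍ) (k : ℤ) :
    ‖nomePow l τ k‖ = Real.exp (-(width τ * (k + l))) := by
  rw [nomePow, Complex.norm_exp, width]
  congr 1
  have : (2 * Real.pi * Complex.I * (τ : ℂ) * ((k : ℂ) + l))
      = ((2 * Real.pi * (k + l) : ℝ) : ℂ) * (Complex.I * τ) := by push_cast; ring
  rw [this, Complex.re_ofReal_mul]
  simp
  ring

lemma norm_exp_add_mul (l : ℝ) (k : ℤ) (z : ℂ) :
    ‖Complex.exp (((k : ℂ) + l) * z)‖ = Real.exp ((k + l) * z.re) := by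
  rw [Complex.norm_exp]
  congr 1
  have : ((k : ℂ) + l) * z = ((k + l : ℝ) : ℂ) * z := by push_cast; ring
  rw [this, Complex.re_ofReal_mul]

section

variable {a : ℂ} {l : ℝ} {τ : ℍ}

/-- Since |a| = 1, a zero forces |q^(k+l)| = 1, hence k + l = 0, so k = l = 0 and a = 1. -/
lemma one_sub_mul_nomePow_ne_zero (ha : ‖a‖ = 1) (hl : l ∈ Set.Ico (0 : ℝ) 1)
    (h : l = 0 → a ≠ 1) (k : ℤ) : 1 - a * nomePow l τ k ≠ 0 := by
  intro h0
  have h1 : a * nomePow l τ k = 1 := (sub_eq_zero.1 h0).symm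
  have h2 := congrArg norm h1
  rw [norm_mul, ha, one_mul, norm_one, norm_nomePow, Real.exp_eq_one_iff] at h2
  have hw := (width_pos τ).ne'
  have h3 : (k : ℝ) + l = 0 := by simpa [hw] using h2
  have h4 : k = 0 := by
    have h5 : (-1 : ℝ) < k := by linarith [hl.2]
    have h6 : (k : ℝ) ≤ 0 := by linarith [hl.1]
    have h5' : (-1 : ℤ) < k := by exact_mod_cast h5
    have h6' : k ≤ 0 := by exact_mod_cast h6
    omega
  have h7 : l = 0 := by simpa [h4] using h3
  apply h h7
  simpa [h4, h7, nomePow] using h1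

lemma regCoeff_of_nonneg {k : ℤ} (hne : 1 - a * nomePow l τ k ≠ 0) (hk : 0 ≤ k) :
    regCoeff a l τ k = -(a * nomePow l τ k / (1 - a * nomePow l τ k)) := by
  rw [regCoeff, seriesCoeff, if_pos hk]
  field_simp
  ring

/-- The coefficients tend to -1 as k → ∞, so adding 1 for k ≥ 0 leaves decay like |q|^|k| at both
ends. This is what doubles the strip of convergence. -/
lemma exists_norm_regCoeff_le (ha : ‖a‖ = 1) (hl : l ∈ Set.Ico (0 : ℝ) 1)
    (h : l = 0 → a ≠ 1) :
    ∃ C : ℝ, ∀ k : ℤ, ‖regCoeff a l τ k‖ ≤ C * Real.exp (-(width τ * |(k : ℝ)|)) := by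
  have hw := width_pos τ
  set w := width τ with hwdef
  have d1 : 0 < 1 - Real.exp (-w) := by
    have : Real.exp (-w) < 1 := Real.exp_lt_one_iff.2 (by linarith)
    linarith
  have d2 : 0 < 1 - Real.exp (-(w * (1 - l))) := by
    have : 0 < w * (1 - l) := mul_pos hw (by linarith [hl.2])
    have : Real.exp (-(w * (1 - l))) < 1 := Real.exp_lt_one_iff.2 (by linarith)
    linarith
  -- `C1` comes from |q^(k+l)| ≤ e^(-w) for k ≥ 1, `C2` from |q^(k+l)| ≥ e^(w(1-l)) for k ≤ -1;
  -- either keeps the denominator away from 0.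
  set C1 := 1 / (1 - Real.exp (-w))
  set C2 := Real.exp (w * l) / (1 - Real.exp (-(w * (1 - l))))
  have hC1 : 0 ≤ C1 := by positivity
  have hC2 : 0 ≤ C2 := by positivity
  refine ⟨C1 + C2 + ‖regCoeff a l τ 0‖, fun k => ?_⟩
  rcases lt_trichotomy k 0 with hk | rfl | hk
  · have hk1 : (k : ℝ) ≤ -1 := by exact_mod_cast (by omega : k ≤ -1)
    have habs : |(k : ℝ)| = -k := abs_of_nonpos (by linarith)
    have hn := norm_nomePow l τ k
    rw [← hwdef] at hn
    have h1 : ‖regCoeff a l τ k‖ ≤ C2 * Real.exp (-(w * |(k : ℝ)|)) := by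
      rw [regCoeff, if_neg (by omega), add_zero, seriesCoeff, norm_neg, norm_div, norm_one, habs]
      have h2 : Real.exp (-(w * (k + l))) * (1 - Real.exp (-(w * (1 - l))))
          ≤ ‖1 - a * nomePow l τ k‖ := by
        have h3 : ‖a * nomePow l τ k‖ - ‖(1 : ℂ)‖ ≤ ‖1 - a * nomePow l τ k‖ := by
          rw [norm_sub_rev]; exact norm_sub_norm_le _ _
        rw [norm_mul, ha, one_mul, norm_one, hn] at h3
        refine le_trans ?_ h3
        rw [mul_sub, mul_one, ← Real.exp_add]
        have : (1 : ℝ) ≤ Real.exp (-(w * (k + l)) + -(w * (1 - l))) := by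
          apply Real.one_le_exp
          nlinarith
        linarith
      calc 1 / ‖1 - a * nomePow l τ k‖
          ≤ 1 / (Real.exp (-(w * (k + l))) * (1 - Real.exp (-(w * (1 - l))))) :=
            one_div_le_one_div_of_le (by positivity) h2
        _ = C2 * Real.exp (-(w * -k)) := by
            simp only [C2]
            rw [show -(w * (k + l)) = -(w * l) + w * -k by ring, Real.exp_add, Real.exp_neg,
              Real.exp_neg (w * -k)]
            field_simp
    refine h1.trans ?_
    gcongr
    have := norm_nonneg (regCoeff a l τ 0)
    linarith
  · have := norm_nonneg (regCoeff a l τ 0)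
    simp
    linarith
  · have hk1 : (1 : ℝ) ≤ k := by exact_mod_cast hk
    have habs : |(k : ℝ)| = k := abs_of_nonneg (by linarith)
    have hn := norm_nomePow l τ k
    rw [← hwdef] at hn
    have h1 : ‖regCoeff a l τ k‖ ≤ C1 * Real.exp (-(w * |(k : ℝ)|)) := by
      rw [regCoeff_of_nonneg (one_sub_mul_nomePow_ne_zero ha hl h k) hk.le, norm_neg, norm_div,
        norm_mul, ha, one_mul, habs, hn]
      have h2 : 1 - Real.exp (-w) ≤ ‖1 - a * nomePow l τ k‖ := by
        have h3 : ‖(1 : ℂ)‖ - ‖a * nomePow l τ k‖ ≤ ‖1 - a * nomePow l τ k‖ := norm_sub_norm_le _ _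
        rw [norm_mul, ha, one_mul, norm_one, hn] at h3
        refine le_trans ?_ h3
        have : Real.exp (-(w * (k + l))) ≤ Real.exp (-w) := by
          apply Real.exp_le_exp.2
          nlinarith [hl.1]
        linarith
      have h4 : Real.exp (-(w * (k + l))) ≤ Real.exp (-(w * k)) := by
        apply Real.exp_le_exp.2
        nlinarith [hl.1]
      rw [show C1 * Real.exp (-(w * k)) = Real.exp (-(w * k)) / (1 - Real.exp (-w)) by
        simp only [C1]; ring]
      gcongr
    refine h1.trans ?_
    gcongr
    have := norm_nonneg (regCoeff a l τ 0)
    linarith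

lemma summable_exp_neg_mul_abs {c : ℝ} (hc : 0 < c) :
    Summable fun k : ℤ => Real.exp (-(c * |(k : ℝ)|)) := by
  have : Summable fun n : ℕ => Real.exp (-(c * n)) := by
    refine (summable_geometric_of_lt_one (Real.exp_pos (-c)).le
      (Real.exp_lt_one_iff.2 (by linarith))).congr fun n => ?_
    rw [← Real.exp_nat_mul]
    congr 1
    ring
  refine Summable.of_nat_of_neg ?_ ?_ <;> simpa using this

lemma exists_summable_bound_regSeries (ha : ‖a‖ = 1) (hl : l ∈ Set.Ico (0 : ℝ) 1)
    (h : l = 0 → a ≠ 1) {r : ℝ} (hr : r < width τ) :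
    ∃ u : ℤ → ℝ, Summable u ∧ ∀ (k : ℤ) (z : ℂ), |z.re| ≤ r →
      ‖regCoeff a l τ k * Complex.exp (((k : ℂ) + l) * z)‖ ≤ u k := by
  obtain ⟨C, hC⟩ := exists_norm_regCoeff_le (τ := τ) ha hl h
  have hC0 : 0 ≤ C := by
    have := (norm_nonneg _).trans (hC 0)
    simpa using this
  refine ⟨fun k => C * Real.exp r * Real.exp (-((width τ - r) * |(k : ℝ)|)),
    (summable_exp_neg_mul_abs (by linarith)).mul_left _, fun k z hz => ?_⟩
  rw [norm_mul, norm_exp_add_mul]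
  have h1 : (k + l) * z.re ≤ |(k : ℝ)| * r + r := by
    have h2 : (k : ℝ) * z.re ≤ |(k : ℝ)| * r :=
      (le_abs_self _).trans (by rw [abs_mul]; gcongr)
    have h3 : l * z.re ≤ r := by
      refine (le_abs_self _).trans ?_
      rw [abs_mul, abs_of_nonneg hl.1]
      have := abs_nonneg z.re
      nlinarith [hl.2]
    linarith
  calc _ ≤ C * Real.exp (-(width τ * |(k : ℝ)|)) * Real.exp (|(k : ℝ)| * r + r) := by
        gcongr; exact hC k
    _ = _ := by
        rw [mul_assoc, ← Real.exp_add]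
        simp only [mul_assoc]
        rw [← Real.exp_add]
        congr 2
        ring

lemma summable_regSeries (ha : ‖a‖ = 1) (hl : l ∈ Set.Ico (0 : ℝ) 1)
    (h : l = 0 → a ≠ 1) {z : ℂ} (hz : |z.re| < width τ) :
    Summable fun k : ℤ => regCoeff a l τ k * Complex.exp (((k : ℂ) + l) * z) := by
  obtain ⟨u, hu, hb⟩ := exists_summable_bound_regSeries (τ := τ) ha hl h hz
  exact Summable.of_norm_bounded hu fun k => hb k z le_rfl

lemma isOpen_strip (w : ℝ) : IsOpen {z : ℂ | |z.re| < w} :=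
  isOpen_lt (by fun_prop) continuous_const

lemma differentiableOn_regSeries (ha : ‖a‖ = 1) (hl : l ∈ Set.Ico (0 : ℝ) 1)
    (h : l = 0 → a ≠ 1) :
    DifferentiableOn ℂ (regSeries a l τ) {z | |z.re| < width τ} := by
  intro z hz
  obtain ⟨r, hr1, hr2⟩ := exists_between (show |z.re| < width τ from hz)
  obtain ⟨u, hu, hb⟩ := exists_summable_bound_regSeries (τ := τ) ha hl h hr2
  have := Complex.differentiableOn_tsum_of_summable_norm (U := {z : ℂ | |z.re| < r}) hu
    (F := fun (k : ℤ) z => regCoeff a l τ k * Complex.exp (((k : ℂ) + l) * z))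
    (fun k => by fun_prop) (isOpen_strip r) (fun k z hz => hb k z (le_of_lt hz))
  exact (this.differentiableAt ((isOpen_strip r).mem_nhds hr1)).differentiableWithinAt

lemma regSeries_add_two_pi_I (z : ℂ) :
    regSeries a l τ (z + 2 * Real.pi * Complex.I)
      = Complex.exp (2 * Real.pi * Complex.I * l) * regSeries a l τ z := by
  rw [regSeries, regSeries, ← tsum_mul_left]
  refine tsum_congr fun k => ?_
  rw [mul_left_comm, ← Complex.exp_add]
  congr 1
  rw [Complex.exp_eq_exp_iff_exists_int]
  exact ⟨k, by ring⟩

/-- The geometric part of the deformed series. -/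
def geomPart (l : ℝ) (z : ℂ) : ℂ := Complex.exp (l * z) / (Complex.exp z - 1)

lemma hasSum_geomPart_of_neg {z : ℂ} (hz : z.re < 0) :
    HasSum (fun k : ℤ => if 0 ≤ k then Complex.exp (((k : ℂ) + l) * z) else 0)
      (-geomPart l z) := by
  have h1 : ‖Complex.exp z‖ < 1 := by rw [Complex.norm_exp]; exact Real.exp_lt_one_iff.2 hz
  have h2 := (hasSum_geometric_of_norm_lt_one h1).mul_left (Complex.exp (l * z))
  have h3 : Complex.exp z - 1 ≠ 0 := fun h => by
    rw [sub_eq_zero.1 h] at h1; simp at h1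
  have h3' : 1 - Complex.exp z ≠ 0 := by rwa [← neg_sub, neg_ne_zero]
  have := HasSum.of_nat_of_neg_add_one
    (f := fun k : ℤ => if 0 ≤ k then Complex.exp (((k : ℂ) + l) * z) else 0)
    (m := -geomPart l z) (m' := 0) ?_ ?_
  · simpa using this
  · convert! h2 using 1
    · funext n
      rw [if_pos (by positivity), ← Complex.exp_nat_mul, ← Complex.exp_add]
      congr 1
      push_cast
      ring
    · rw [geomPart]
      field_simp
      ring
  · convert! hasSum_zero using 2

lemma hasSum_geomPart_of_pos {z : ℂ} (hz : 0 < z.re) :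
    HasSum (fun k : ℤ => if 0 ≤ k then 0 else Complex.exp (((k : ℂ) + l) * z))
      (geomPart l z) := by
  have h1 : ‖Complex.exp (-z)‖ < 1 := by
    rw [Complex.norm_exp]; exact Real.exp_lt_one_iff.2 (by simpa using hz)
  have h2 := (hasSum_geometric_of_norm_lt_one h1).mul_left (Complex.exp (l * z - z))
  have h3 : 1 - Complex.exp (-z) ≠ 0 := fun h => by
    rw [← sub_eq_zero.1 h] at h1; simp at h1
  have := HasSum.of_nat_of_neg_add_one
    (f := fun k : ℤ => if 0 ≤ k then 0 else Complex.exp (((k : ℂ) + l) * z))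
    (m := 0) (m' := geomPart l z) ?_ ?_
  · simpa using this
  · convert! hasSum_zero using 2
  · convert! h2 using 1
    · funext n
      rw [if_neg (by omega), ← Complex.exp_nat_mul, ← Complex.exp_add]
      congr 1
      push_cast
      ring
    · have h4 : Complex.exp z - 1 = Complex.exp z * (1 - Complex.exp (-z)) := by
        rw [mul_sub, ← Complex.exp_add]; simp
      rw [geomPart, h4, Complex.exp_sub]
      field_simp

lemma hasSum_series_of_neg (ha : ‖a‖ = 1) (hl : l ∈ Set.Ico (0 : ℝ) 1)
    (h : l = 0 → a ≠ 1) {z : ℂ} (hz : -width τ < z.re) (hz0 : z.re < 0) :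
    HasSum (fun k : ℤ => seriesCoeff a l τ k * Complex.exp (((k : ℂ) + l) * z))
      (regSeries a l τ z + geomPart l z) := by
  have hz' : |z.re| < width τ := abs_lt.2 ⟨hz, hz0.trans (width_pos τ)⟩
  have := ((summable_regSeries ha hl h hz').hasSum).sub (hasSum_geomPart_of_neg (l := l) hz0)
  rw [sub_neg_eq_add] at this
  refine this.congr_fun fun k => ?_
  rw [regCoeff]
  split_ifs <;> ring

/-- A coefficient c = -1/(1 - aq^(k+l)) satisfies a q^(k+l) c = c + 1. To the right of Re z = 0 the
geometric part expands over k < 0 instead of k ≥ 0, so both sides have coefficients c + 1. -/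
lemma mul_regSeries_add_geomPart (ha : ‖a‖ = 1) (hl : l ∈ Set.Ico (0 : ℝ) 1)
    (h : l = 0 → a ≠ 1) {z : ℂ} (hz : 0 < z.re) (hz1 : z.re < width τ) :
    a * (regSeries a l τ (z + 2 * Real.pi * Complex.I * τ)
      + geomPart l (z + 2 * Real.pi * Complex.I * τ)) = regSeries a l τ z + geomPart l z := by
  have hz' : |z.re| < width τ := abs_lt.2 ⟨by linarith [width_pos τ], hz1⟩
  have hre : (z + 2 * Real.pi * Complex.I * τ).re = z.re - width τ := by
    have : (2 * Real.pi * Complex.I * (τ : ℂ)) = ((2 * Real.pi : ℝ) : ℂ) * (Complex.I * τ) := by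
      push_cast; ring
    rw [Complex.add_re, this, Complex.re_ofReal_mul, width]
    simp
    ring
  have h1 := (hasSum_series_of_neg (τ := τ) ha hl h (z := z + 2 * Real.pi * Complex.I * τ)
    (by rw [hre]; linarith) (by rw [hre]; linarith)).mul_left a
  have h2 := ((summable_regSeries ha hl h hz').hasSum).add (hasSum_geomPart_of_pos (l := l) hz)
  refine h1.unique (h2.congr_fun fun k => ?_)
  have hden := one_sub_mul_nomePow_ne_zero (τ := τ) ha hl h k
  have he : Complex.exp (((k : ℂ) + l) * (z + 2 * Real.pi * Complex.I * τ))
      = nomePow l τ k * Complex.exp (((k : ℂ) + l) * z) := by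
    rw [nomePow, ← Complex.exp_add]
    congr 1
    ring
  have hs : a * (seriesCoeff a l τ k * nomePow l τ k) = seriesCoeff a l τ k + 1 := by
    rw [seriesCoeff]
    field_simp
    ring
  rw [he, regCoeff]
  split_ifs <;> linear_combination Complex.exp (((k : ℂ) + l) * z) * hs

end

/-! ### Identification of P₁ with the Kronecker quotient. -/

lemma norm_multiplier (t : ℝ) : ‖multiplier t‖ = 1 := by
  rw [multiplier, show (-2 * Real.pi * Complex.I * t : ℂ) = ((-2 * Real.pi * t : ℝ) : ℂ) * Complex.I by
    push_cast; ring, Complex.norm_exp_ofReal_mul_I]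

lemma multiplier_intCast (n : ℤ) : multiplier n = 1 := by
  rw [multiplier, Complex.exp_eq_one_iff]
  exact ⟨-n, by push_cast; ring⟩

/-- A zero would put 2πi(α - βτ) in the lattice, making α and β integers and both multipliers 1. -/
lemma theta_shifted_zero_ne_zero {α β : ℝ} (τ : ℍ)
    (h : (multiplier α, multiplier β) ≠ ((1, 1) : ℂ × ℂ)) :
    theta (1 / 2 - β) (1 / 2 + α) 0 τ ≠ 0 := by
  rw [theta_shift]
  refine mul_ne_zero (Complex.exp_ne_zero _) (theta_half_ne_zero ?_)
  rintro ⟨a, b, hab⟩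
  rw [zero_add] at hab
  have h1 := mul_left_cancel₀ Complex.two_pi_I_ne_zero hab
  have him := congrArg Complex.im h1
  have hre := congrArg Complex.re h1
  simp only [Complex.sub_im, Complex.add_im, Complex.mul_im, Complex.ofReal_re, Complex.ofReal_im,
    Complex.intCast_im, Complex.intCast_re, Complex.sub_re, Complex.add_re, Complex.mul_re,
    zero_mul, add_zero, zero_sub, sub_zero, UpperHalfPlane.coe_im, UpperHalfPlane.coe_re] at him hre
  have hβ : β = ((-a : ℤ) : ℝ) := by
    have := τ.im_pos.ne'
    have h2 : (-β) * τ.im = a * τ.im := by linarith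
    have := mul_right_cancel₀ this h2
    push_cast
    linarith
  have hα : α = (b : ℝ) := by
    rw [hβ] at hre
    push_cast at hre
    linarith
  apply h
  rw [hα, hβ, multiplier_intCast, multiplier_intCast]

/-- The holomorphic quotient `ϑ₁(z) / (eᶻ - 1)`. -/
def thetaReg (τ : ℍ) (z : ℂ) : ℂ :=
  Complex.exp (Complex.I * Real.pi * τ / 4 + Real.pi * Complex.I / 2) * Complex.exp (-(z / 2)) *
    tripleProd (nome τ) z

lemma theta_half_eq_mul_thetaReg (z : ℂ) (τ : ℍ) :
    theta (1 / 2) (1 / 2) z τ = (Complex.exp z - 1) * thetaReg τ z := by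
  rw [theta_half_eq_tripleProd, thetaReg]
  have h : Complex.exp (z / 2) * (1 - Complex.exp (-z))
      = (Complex.exp z - 1) * Complex.exp (-(z / 2)) := by
    rw [mul_sub, sub_mul, ← Complex.exp_add, ← Complex.exp_add]
    ring_nf
  linear_combination Complex.exp (Complex.I * Real.pi * τ / 4 + Real.pi * Complex.I / 2)
    * tripleProd (nome τ) z * h

lemma differentiable_thetaReg (τ : ℍ) : Differentiable ℂ (thetaReg τ) := by
  have := differentiable_tripleProd (norm_nome_lt_one τ)
  unfold thetaReg
  fun_prop

lemma thetaReg_add_two_pi_I (z : ℂ) (τ : ℍ) :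
    thetaReg τ (z + 2 * Real.pi * Complex.I) = -thetaReg τ z := by
  rw [thetaReg, thetaReg, tripleProd_add_two_pi_I,
    show -((z + 2 * Real.pi * Complex.I) / 2) = -(z / 2) - Real.pi * Complex.I by ring,
    Complex.exp_sub, Complex.exp_pi_mul_I]
  ring

lemma thetaReg_zero (τ : ℍ) :
    thetaReg τ 0 = deriv (fun z => theta (1 / 2) (1 / 2) z τ) 0 := by
  simp_rw [theta_half_eq_mul_thetaReg]
  have h1 : HasDerivAt (fun z : ℂ => Complex.exp z - 1) 1 0 := by
    simpa using (Complex.hasDerivAt_exp 0).sub_const 1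
  have h2 := h1.fun_mul (differentiable_thetaReg τ 0).hasDerivAt
  rw [h2.deriv]
  simp

/-- A vanishing factor needs |eᶻ| = |q|^(-n) with n ≠ 0, that is |Re z| = |n| · `width τ`, outside
the strip. -/
lemma thetaReg_ne_zero {z : ℂ} {τ : ℍ} (hz : |z.re| < width τ) : thetaReg τ z ≠ 0 := by
  refine mul_ne_zero (mul_ne_zero (Complex.exp_ne_zero _) (Complex.exp_ne_zero _))
    (tripleProd_ne_zero fun n hn h => ?_)
  have h1 := congrArg norm h
  have h2 : ‖nome τ‖ = Real.exp (-width τ) := by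
    have := norm_nomePow 0 τ 1
    simpa [nomePow, nome] using this
  rw [norm_mul, Complex.norm_exp, norm_zpow, h2, norm_one, ← Real.rpow_intCast, ← Real.exp_mul, ← Real.exp_add,
    Real.exp_eq_one_iff] at h1
  have h3 : z.re = n * width τ := by linarith
  have hw := width_pos τ
  rw [h3, abs_mul, abs_of_pos hw] at hz
  have h4 : (1 : ℝ) ≤ |(n : ℝ)| := by exact_mod_cast Int.one_le_abs hn
  nlinarith

lemma deriv_theta_half_zero_ne_zero (τ : ℍ) :
    deriv (fun z => theta (1 / 2) (1 / 2) z τ) 0 ≠ 0 := by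
  rw [← thetaReg_zero]
  exact thetaReg_ne_zero (by simpa using width_pos τ)

/-- The quotient of theta functions that evaluates the deformed series. -/
def kronecker (α β : ℝ) (τ : ℍ) (z : ℂ) : ℂ :=
  deriv (fun z => theta (1 / 2) (1 / 2) z τ) 0 / theta (1 / 2 - β) (1 / 2 + α) 0 τ *
    (theta (1 / 2 - β) (1 / 2 + α) z τ / theta (1 / 2) (1 / 2) z τ)

lemma kronecker_add_two_pi_I_mul (α β : ℝ) (τ : ℍ) (z : ℂ) :
    kronecker α β τ (z + 2 * Real.pi * Complex.I * τ) = multiplier α * kronecker α β τ z := by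
  rw [kronecker, kronecker, theta_add_two_pi_I_mul, theta_add_two_pi_I_mul]
  have h : Complex.exp (-(Complex.I * Real.pi * τ) - z
      - 2 * Real.pi * Complex.I * ((1 / 2 + α : ℝ) : ℂ))
      = multiplier α * Complex.exp (-(Complex.I * Real.pi * τ) - z
      - 2 * Real.pi * Complex.I * ((1 / 2 : ℝ) : ℂ)) := by
    rw [multiplier, ← Complex.exp_add]
    congr 1
    push_cast
    ring
  rw [h, mul_assoc, mul_div_assoc, mul_div_mul_left _ _ (Complex.exp_ne_zero _)]
  ring

/-- Where eᶻ = 1 the denominator has a simple zero with derivative 1, so the removable value is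
N'(z). -/
lemma differentiableOn_div_exp_sub_one {N : ℂ → ℂ} {V : Set ℂ} (hV : IsOpen V)
    (hN : DifferentiableOn ℂ N V) (h0 : ∀ z ∈ V, Complex.exp z = 1 → N z = 0) :
    DifferentiableOn ℂ (fun z => if Complex.exp z = 1 then deriv N z
      else N z / (Complex.exp z - 1)) V := by
  intro z₀ hz₀
  have hNa : AnalyticAt ℂ N z₀ := hN.analyticAt (hV.mem_nhds hz₀)
  refine DifferentiableAt.differentiableWithinAt ?_
  by_cases he : Complex.exp z₀ = 1
  · have hd : ∀ {f : ℂ → ℂ}, AnalyticAt ℂ f z₀ → AnalyticAt ℂ (dslope f z₀) z₀ := by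
      rintro f ⟨p, hp⟩
      exact ⟨_, hp.has_fpower_series_dslope_fslope⟩
    have hexp : AnalyticAt ℂ Complex.exp z₀ := Complex.differentiable_exp.analyticAt z₀
    have hne : dslope Complex.exp z₀ z₀ ≠ 0 := by
      rw [dslope_same]; simp
    have hq : AnalyticAt ℂ (fun z => dslope N z₀ z / dslope Complex.exp z₀ z) z₀ :=
      (hd hNa).fun_div (hd hexp) hne
    refine hq.differentiableAt.congr_of_eventuallyEq ?_
    filter_upwards [(hd hexp).continuousAt.eventually_ne hne] with z hz
    by_cases hzz : z = z₀
    · subst hzz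
      rw [if_pos he, dslope_same, dslope_same]
      simp [he]
    · have h1 : (z - z₀) * dslope Complex.exp z₀ z = Complex.exp z - 1 := by
        have := sub_smul_dslope Complex.exp z₀ z
        rwa [he, smul_eq_mul] at this
      have h2 : (z - z₀) * dslope N z₀ z = N z := by
        have := sub_smul_dslope N z₀ z
        rwa [h0 z₀ hz₀ he, smul_eq_mul, sub_zero] at this
      have h3 : z - z₀ ≠ 0 := sub_ne_zero.2 hzz
      have h4 : Complex.exp z ≠ 1 := by
        rw [← sub_ne_zero, ← h1]
        exact mul_ne_zero h3 hz
      rw [if_neg h4, ← h1, ← h2, mul_div_mul_left _ _ h3]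
  · have hc : ∀ᶠ z in 𝓝 z₀, Complex.exp z ≠ 1 :=
      Complex.continuous_exp.continuousAt.eventually_ne he
    have h1 : DifferentiableAt ℂ (fun z => N z / (Complex.exp z - 1)) z₀ :=
      hNa.differentiableAt.fun_div (by fun_prop) (sub_ne_zero.2 he)
    refine h1.congr_of_eventuallyEq ?_
    filter_upwards [hc] with z hz
    rw [if_neg hz]

/-- A holomorphic function on the strip `|Re z| < w` with unimodular multipliers, not both `1`,
along `2πi` and `2πiτ` vanishes. -/
lemma eq_zero_of_multipliers {τ : ℍ} {F : ℂ → ℂ} {a φ : ℂ}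
    (hF : DifferentiableOn ℂ F {z | |z.re| < width τ}) (ha : ‖a‖ = 1) (hφ : ‖φ‖ = 1)
    (hne : a ≠ 1 ∨ φ ≠ 1)
    (h1 : ∀ z, |z.re| < width τ → F (z + 2 * Real.pi * Complex.I) = φ * F z)
    (h2 : ∀ z, 0 < z.re → z.re < width τ → F z = a * F (z + 2 * Real.pi * Complex.I * τ))
    {z : ℂ} (hz : |z.re| < width τ) : F z = 0 := by
  have hw := width_pos τ
  have hreτ : ∀ z : ℂ, (z + 2 * Real.pi * Complex.I * τ).re = z.re - width τ := fun z => by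
    have : (2 * Real.pi * Complex.I * (τ : ℂ)) = ((2 * Real.pi : ℝ) : ℂ) * (Complex.I * τ) := by
      push_cast; ring
    rw [Complex.add_re, this, Complex.re_ofReal_mul, width]
    simp
    ring
  have hre1 : ∀ (z : ℂ) (n : ℤ), (z + n * (2 * Real.pi * Complex.I)).re = z.re := fun z n => by
    simp
  have him1 : ∀ (z : ℂ) (n : ℤ), (z + n * (2 * Real.pi * Complex.I)).im = z.im + n * (2 * Real.pi) :=
    fun z n => by simp
  -- norms are invariant
  have hn1 : ∀ (n : ℤ) z, |z.re| < width τ → ‖F (z + n * (2 * Real.pi * Complex.I))‖ = ‖F z‖ := by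
    intro n
    induction n using Int.induction_on with
    | zero => simp
    | succ n ih =>
      intro z hz
      have h := h1 (z + (n : ℤ) * (2 * Real.pi * Complex.I)) (by rwa [hre1])
      rw [← ih z hz, ← one_mul ‖F (z + (n : ℤ) * _)‖, ← hφ, ← norm_mul, ← h]
      congr 2
      push_cast
      ring
    | pred n ih =>
      intro z hz
      have h := h1 (z + ((-(n : ℤ) - 1 : ℤ) : ℂ) * (2 * Real.pi * Complex.I)) (by rwa [hre1])
      rw [← ih z hz, ← one_mul ‖F (z + ((-(n : ℤ) - 1 : ℤ) : ℂ) * _)‖, ← hφ, ← norm_mul, ← h]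
      congr 2
      push_cast
      ring
  have hn2 : ∀ z, 0 < z.re → z.re < width τ →
      ‖F (z + 2 * Real.pi * Complex.I * τ)‖ = ‖F z‖ := by
    intro z hz hz'
    rw [h2 z hz hz', norm_mul, ha, one_mul]
  -- A compact rectangle to which every point of the strip can be moved by the two translations
  -- without changing the norm of F, so the maximum over the whole strip is attained.
  set Q : Set ℂ := Set.Icc (-(width τ / 2)) (width τ / 2) ×ℂ Set.Icc 0 (2 * Real.pi) with hQ
  have hQc : IsCompact Q := isCompact_Icc.reProdIm isCompact_Icc
  have hQs : Q ⊆ {z | |z.re| < width τ} := by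
    intro z hz
    have := (Complex.mem_reProdIm.1 hz).1
    obtain ⟨l1, l2⟩ := this
    change |z.re| < width τ
    rw [abs_lt]
    constructor <;> linarith
  have hred1 : ∀ z : ℂ, |z.re| ≤ width τ / 2 → ∃ y ∈ Q, ‖F y‖ = ‖F z‖ := by
    intro z hz
    refine ⟨z + ((-⌊z.im / (2 * Real.pi)⌋ : ℤ) : ℂ) * (2 * Real.pi * Complex.I), ?_,
      hn1 _ z (by linarith)⟩
    have hpi : (0 : ℝ) < 2 * Real.pi := by positivity
    rw [hQ, Complex.mem_reProdIm, hre1, him1]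
    refine ⟨abs_le.1 hz, ?_⟩
    have f1 := Int.floor_le (z.im / (2 * Real.pi))
    have f2 := Int.lt_floor_add_one (z.im / (2 * Real.pi))
    rw [le_div_iff₀ hpi] at f1
    rw [div_lt_iff₀ hpi] at f2
    push_cast
    constructor <;> linarith
  have hred : ∀ z : ℂ, |z.re| < width τ → ∃ y ∈ Q, ‖F y‖ = ‖F z‖ := by
    intro z hz
    have hz' := abs_lt.1 hz
    by_cases c1 : width τ / 2 < z.re
    · obtain ⟨y, hy, he⟩ := hred1 (z + 2 * Real.pi * Complex.I * τ) (by
        rw [hreτ, abs_le]; constructor <;> linarith)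
      exact ⟨y, hy, he.trans (hn2 z (by linarith) hz'.2)⟩
    by_cases c2 : z.re < -(width τ / 2)
    · have hre : (z - 2 * Real.pi * Complex.I * τ).re = z.re + width τ := by
        have := hreτ (z - 2 * Real.pi * Complex.I * τ)
        rw [sub_add_cancel] at this
        linarith
      obtain ⟨y, hy, he⟩ := hred1 (z - 2 * Real.pi * Complex.I * τ) (by
        rw [hre, abs_le]; constructor <;> linarith)
      refine ⟨y, hy, he.trans ?_⟩
      have := hn2 (z - 2 * Real.pi * Complex.I * τ) (by rw [hre]; linarith) (by rw [hre]; linarith)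
      rw [← this, sub_add_cancel]
    · exact hred1 z (abs_le.2 ⟨by linarith, by linarith⟩)
  have hQne : Q.Nonempty := ⟨0, by
    rw [hQ, Complex.mem_reProdIm]
    refine ⟨⟨?_, ?_⟩, ⟨?_, ?_⟩⟩ <;> simp <;> positivity⟩
  obtain ⟨p, hp, hmax⟩ := hQc.exists_isMaxOn hQne (hF.continuousOn.mono hQs).norm
  have hpV : |p.re| < width τ := hQs hp
  have hmax' : IsMaxOn (norm ∘ F) {z | |z.re| < width τ} p := by
    intro z hz
    obtain ⟨y, hy, he⟩ := hred z hz
    have := hmax hy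
    simp only [Set.mem_ofPred_eq, Function.comp] at this ⊢
    rwa [← he]
  have hconv : Convex ℝ {z : ℂ | |z.re| < width τ} := by
    have : {z : ℂ | |z.re| < width τ} = Complex.reLm ⁻¹' (Set.Ioo (-width τ) (width τ)) := by
      ext z; simp [abs_lt]
    rw [this]
    exact (convex_Ioo _ _).linear_preimage _
  have hconst := Complex.eqOn_of_isPreconnected_of_isMaxOn_norm hconv.isPreconnected
    (isOpen_strip _) hF hpV hmax'
  have hc : ∀ z : ℂ, |z.re| < width τ → F z = F p := fun z hz => hconst hz
  rw [hc z hz]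
  -- A constant with a multiplier different from 1 is 0.
  rcases hne with h | h
  · have hh := h2 (width τ / 2 : ℝ) (by simp; positivity) (by simp; linarith)
    rw [hc _ (by rw [Complex.ofReal_re, abs_of_pos (by positivity)]; linarith),
      hc (_ + _) (by rw [hreτ, Complex.ofReal_re, abs_lt]; constructor <;> linarith)] at hh
    by_contra hF0
    exact h (mul_right_cancel₀ hF0 (by rw [one_mul]; exact hh.symm))
  · have hh := h1 p hpV
    rw [hc (_ + _) (by have := hre1 p 1; push_cast at this; rw [one_mul] at this; rwa [this])] at hh
    by_contra hF0
    exact h (mul_right_cancel₀ hF0 (by rw [one_mul]; exact hh.symm))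

/-- The Kronecker quotient is the sum of the deformed series on its strip. -/
theorem kronecker_eq_deformedSeries {α β : ℝ} {τ : ℍ}
    (hαβ : (multiplier α, multiplier β) ≠ ((1, 1) : ℂ × ℂ)) {z : ℂ} (hz : -width τ < z.re)
    (hz0 : z.re < 0) :
    kronecker α β τ z = deformedSeries (multiplier α) (multiplier β) z τ := by
  set l := lam (multiplier β) with hl
  set a := (multiplier α)⁻¹ with ha
  have hl01 : l ∈ Set.Ico (0 : ℝ) 1 := lam_mem _
  have hφ : Complex.exp (2 * Real.pi * Complex.I * l) = multiplier β := exp_lam (norm_multiplier β)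
  have hmα : multiplier α ≠ 0 := Complex.exp_ne_zero _
  have ha1 : ‖a‖ = 1 := by rw [ha, norm_inv, norm_multiplier, inv_one]
  have hla : l = 0 → a ≠ 1 := by
    intro h0 h1
    apply hαβ
    rw [h0] at hφ
    rw [← hφ, ← inv_inv (multiplier α), ← ha, h1]
    simp
  have hne : a ≠ 1 ∨ multiplier β ≠ 1 := by
    by_contra! h
    apply hαβ
    rw [h.2, ← inv_inv (multiplier α), ← ha, h.1, inv_one]
  set T0 := deriv (fun z => theta (1 / 2) (1 / 2) z τ) 0 with hT0
  set S : ℂ → ℂ := fun z => theta (1 / 2 - β) (1 / 2 + α) z τ with hS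
  have hSd : Differentiable ℂ S := differentiable_theta _ _ _
  have hS0 : S 0 ≠ 0 := theta_shifted_zero_ne_zero τ hαβ
  -- Chosen so that N/(eᶻ - 1) is the Kronecker quotient minus the geometric part; N vanishes on
  -- 2πiℤ, so the poles cancel.
  set N : ℂ → ℂ := fun z => T0 / S 0 * (S z / thetaReg τ z) - Complex.exp (l * z) with hN
  have hNper : ∀ z, N (z + 2 * Real.pi * Complex.I) = multiplier β * N z := by
    intro z
    simp only [hN, hS]
    rw [theta_add_two_pi_I, thetaReg_add_two_pi_I, mul_add, Complex.exp_add,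
      mul_comm (l : ℂ) (2 * Real.pi * Complex.I), hφ]
    -- The sign from the characteristic ½ cancels the sign that `thetaReg` picks up.
    have : Complex.exp (2 * Real.pi * Complex.I * ((1 / 2 - β : ℝ) : ℂ)) = -multiplier β := by
      rw [multiplier, neg_eq_neg_one_mul, ← Complex.exp_pi_mul_I, ← Complex.exp_add]
      congr 1
      push_cast
      ring
    rw [this]
    ring
  have hVo := isOpen_strip (width τ)
  have hNd : DifferentiableOn ℂ N {z | |z.re| < width τ} := by
    intro z hz
    have h1 := hSd z
    have h2 := differentiable_thetaReg τ z
    have h3 := thetaReg_ne_zero (show |z.re| < width τ from hz)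
    exact (((h1.fun_div h2 h3).const_mul _).fun_sub (by fun_prop)).differentiableWithinAt
  have hN0 : N 0 = 0 := by
    simp only [hN]
    rw [thetaReg_zero, ← hT0]
    have := deriv_theta_half_zero_ne_zero τ
    rw [← hT0] at this
    field_simp
    simp
  have hNz : ∀ n : ℤ, N (n * (2 * Real.pi * Complex.I)) = 0 := by
    intro n
    induction n using Int.induction_on with
    | zero => simpa using hN0
    | succ n ih =>
      have := hNper ((n : ℤ) * (2 * Real.pi * Complex.I))
      rw [ih, mul_zero] at this
      rw [← this]
      congr 1
      push_cast
      ring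
    | pred n ih =>
      have := hNper (((-(n : ℤ) - 1 : ℤ) : ℂ) * (2 * Real.pi * Complex.I))
      rw [show ((-(n : ℤ) - 1 : ℤ) : ℂ) * (2 * Real.pi * Complex.I) + 2 * Real.pi * Complex.I
        = ((-(n : ℤ) : ℤ) : ℂ) * (2 * Real.pi * Complex.I) by push_cast; ring, ih] at this
      exact (mul_eq_zero.1 this.symm).resolve_left (Complex.exp_ne_zero _)
  set F : ℂ → ℂ := fun z => (if Complex.exp z = 1 then deriv N z else N z / (Complex.exp z - 1))
    - regSeries a l τ z with hF
  have hFd : DifferentiableOn ℂ F {z | |z.re| < width τ} := by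
    refine (differentiableOn_div_exp_sub_one hVo hNd fun z _ he => ?_).fun_sub
      (differentiableOn_regSeries ha1 hl01 hla)
    obtain ⟨n, rfl⟩ := Complex.exp_eq_one_iff.1 he
    exact hNz n
  have hFK : ∀ z, Complex.exp z ≠ 1 →
      F z = kronecker α β τ z - (regSeries a l τ z + geomPart l z) := by
    intro z hz
    have h1 : Complex.exp z - 1 ≠ 0 := sub_ne_zero.2 hz
    simp only [hF, if_neg hz, hN, kronecker, geomPart, theta_half_eq_mul_thetaReg z τ, ← hT0, hS]
    rw [sub_div, mul_comm (Complex.exp z - 1), ← div_div (theta _ _ z τ), mul_div_assoc]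
    ring
  have hFper : ∀ z, |z.re| < width τ → F (z + 2 * Real.pi * Complex.I) = multiplier β * F z := by
    intro z _
    have hd : deriv N (z + 2 * Real.pi * Complex.I) = multiplier β * deriv N z := by
      rw [← deriv_comp_add_const, ← deriv_const_mul_field]
      congr 1
      funext w
      exact hNper w
    have he : Complex.exp (z + 2 * Real.pi * Complex.I) = Complex.exp z := Complex.exp_periodic z
    simp only [hF, he, hd, hNper, regSeries_add_two_pi_I, hφ]
    split_ifs <;> ring
  have hreτ : ∀ z : ℂ, (z + 2 * Real.pi * Complex.I * τ).re = z.re - width τ := fun z => by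
    have : (2 * Real.pi * Complex.I * (τ : ℂ)) = ((2 * Real.pi : ℝ) : ℂ) * (Complex.I * τ) := by
      push_cast; ring
    rw [Complex.add_re, this, Complex.re_ofReal_mul, width]
    simp
    ring
  have hexp : ∀ z : ℂ, z.re ≠ 0 → Complex.exp z ≠ 1 := by
    intro z hz h
    have := congrArg norm h
    rw [Complex.norm_exp, norm_one, Real.exp_eq_one_iff] at this
    exact hz this
  have hFτ : ∀ z, 0 < z.re → z.re < width τ → F z = a * F (z + 2 * Real.pi * Complex.I * τ) := by
    intro z h0 h1
    rw [hFK z (hexp z h0.ne'), hFK _ (hexp _ (by rw [hreτ]; linarith)), mul_sub,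
      mul_regSeries_add_geomPart ha1 hl01 hla h0 h1, kronecker_add_two_pi_I_mul, ← mul_assoc,
      ha, inv_mul_cancel₀ hmα, one_mul]
  have hzero := eq_zero_of_multipliers hFd ha1 (norm_multiplier β) hne hFper hFτ (z := z)
    (abs_lt.2 ⟨hz, hz0.trans (width_pos τ)⟩)
  rw [hFK z (hexp z hz0.ne), sub_eq_zero] at hzero
  rw [hzero, ← (hasSum_series_of_neg ha1 hl01 hla hz hz0).tsum_eq, deformedSeries, ← tsum_neg]
  refine tsum_congr fun k => ?_
  rw [seriesCoeff, nomePow]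
  ring

lemma countable_lattice (τ : ℍ) : (lattice τ).Countable := by
  have : lattice τ = Set.range fun p : ℤ × ℤ =>
      2 * Real.pi * Complex.I * ((p.1 : ℂ) * (τ : ℂ) + p.2) := by
    ext z
    constructor
    · rintro ⟨a, b, rfl⟩
      exact ⟨(a, b), rfl⟩
    · rintro ⟨⟨a, b⟩, rfl⟩
      exact ⟨a, b, rfl⟩
  rw [this]
  exact Set.countable_range _

lemma isOpen_compl_lattice (τ : ℍ) : IsOpen (lattice τ)ᶜ := by
  have : (lattice τ)ᶜ = {z | theta (1 / 2) (1 / 2) z τ ≠ 0} := by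
    ext z
    rw [Set.mem_compl_iff, ← theta_half_eq_zero_iff, Set.mem_ofPred_eq]
  rw [this]
  exact isOpen_ne_fun (differentiable_theta _ _ τ).continuous continuous_const

lemma analyticOnNhd_kronecker (α β : ℝ) (τ : ℍ) :
    AnalyticOnNhd ℂ (kronecker α β τ) (lattice τ)ᶜ := by
  intro z hz
  exact analyticAt_const.mul (((differentiable_theta _ _ τ).analyticAt z).fun_div
    ((differentiable_theta _ _ τ).analyticAt z) (theta_half_ne_zero hz))

/-- `P₁` is the Kronecker quotient of theta functions. -/
theorem P1_eq_kronecker {α β : ℝ} {τ : ℍ}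
    (hαβ : (multiplier α, multiplier β) ≠ ((1, 1) : ℂ × ℂ)) {z : ℂ} (hz : z ∉ lattice τ) :
    P1 (multiplier α) (multiplier β) z τ = kronecker α β τ z := by
  have hw : -2 * Real.pi * τ.im = -width τ := by rw [width]; ring
  have hK : IsContinuation (multiplier α) (multiplier β) τ (kronecker α β τ) :=
    ⟨analyticOnNhd_kronecker α β τ, fun z h1 h2 => by
      rw [hw] at h1
      exact kronecker_eq_deformedSeries hαβ h1 h2⟩
  -- The Kronecker quotient witnesses that a continuation exists, so the chosen one is genuine; the
  -- identity theorem on the connected complement of the lattice then compares them.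
  have hP : IsContinuation (multiplier α) (multiplier β) τ
      (Classical.epsilon (IsContinuation (multiplier α) (multiplier β) τ)) :=
    Classical.epsilon_spec ⟨_, hK⟩
  have hconn : IsPreconnected (lattice τ)ᶜ :=
    ((countable_lattice τ).isPathConnected_compl_of_one_lt_rank
      (by rw [Complex.rank_real_complex]; norm_num)).isConnected.isPreconnected
  set z₀ : ℂ := ((-(width τ / 2) : ℝ) : ℂ)
  have hwp := width_pos τ
  have hstrip : IsOpen {z : ℂ | -width τ < z.re ∧ z.re < 0} :=
    (isOpen_lt continuous_const Complex.continuous_re).inter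
      (isOpen_lt Complex.continuous_re continuous_const)
  have hz₀s : z₀ ∈ {z : ℂ | -width τ < z.re ∧ z.re < 0} := by
    constructor <;> simp [z₀] <;> linarith
  have hz₀ : z₀ ∈ (lattice τ)ᶜ := by
    rintro ⟨a, b, hab⟩
    have hre := congrArg Complex.re hab
    have h2 : (2 * Real.pi * Complex.I * (a * (τ : ℂ) + b)).re = -(a * width τ) := by
      have : 2 * Real.pi * Complex.I * (a * (τ : ℂ) + b)
          = ((2 * Real.pi : ℝ) : ℂ) * (Complex.I * (((a : ℝ) : ℂ) * τ + ((b : ℝ) : ℂ))) := by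
        push_cast; ring
      rw [this, Complex.re_ofReal_mul, Complex.I_mul_re, Complex.add_im, Complex.im_ofReal_mul,
        Complex.ofReal_im, width, UpperHalfPlane.coe_im]
      ring
    rw [h2, Complex.ofReal_re] at hre
    have h3 : (2 * a : ℝ) * width τ = 1 * width τ := by linarith
    have h4 : (2 * a : ℝ) = 1 := mul_right_cancel₀ hwp.ne' h3
    have h5 : 2 * a = 1 := by exact_mod_cast h4
    omega
  refine hP.1.eqOn_of_preconnected_of_eventuallyEq hK.1 hconn hz₀ ?_ hz
  filter_upwards [hstrip.mem_nhds hz₀s] with y hy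
  have h1 : -2 * Real.pi * τ.im < y.re := by rw [hw]; exact hy.1
  rw [hP.2 y h1 hy.2, hK.2 y h1 hy.2]

/-! ### Determinants of Kronecker quotients, with distinct and with repeated points. -/

/-- Replacing `S` by a translate of ϑ₁ costs a factor exp(-β(u_i - v_j)), which splits into a row
scaling and a column scaling of the Frobenius matrix. -/
lemma det_kronecker {α β : ℝ} {τ : ℍ} (hαβ : (multiplier α, multiplier β) ≠ ((1, 1) : ℂ × ℂ))
    {N : ℕ} (u v : Fin N → ℂ) (huv : ∀ i j, u i - v j ∉ lattice τ) :
    (Matrix.of fun i j => kronecker α β τ (u i - v j)).det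
      = theta (1 / 2 - β) (1 / 2 + α) (∑ i, u i - ∑ j, v j) τ / theta (1 / 2 - β) (1 / 2 + α) 0 τ *
        deriv (fun z => theta (1 / 2) (1 / 2) z τ) 0 ^ N *
        ((∏ a, ∏ b ∈ Iio a, theta (1 / 2) (1 / 2) (u a - u b) τ) *
          ∏ a, ∏ b ∈ Iio a, theta (1 / 2) (1 / 2) (v b - v a) τ) /
          ∏ i, ∏ j, theta (1 / 2) (1 / 2) (u i - v j) τ := by
  have hS0 := theta_shifted_zero_ne_zero τ hαβ
  set T : ℂ → ℂ := fun z => theta (1 / 2) (1 / 2) z τ with hT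
  set T0 := deriv T 0
  change _ = _ / _ * T0 ^ N * ((∏ a, ∏ b ∈ Iio a, T (u a - u b)) *
    ∏ a, ∏ b ∈ Iio a, T (v b - v a)) / ∏ i, ∏ j, T (u i - v j)
  set t : ℂ := 2 * Real.pi * Complex.I * (α - β * τ) with ht
  set c : ℂ := Complex.I * Real.pi * β ^ 2 * τ
    - β * (Real.pi * Complex.I + 2 * Real.pi * Complex.I * α) with hc
  have hS : ∀ z, theta (1 / 2 - β) (1 / 2 + α) z τ
      = Complex.exp c * Complex.exp (-(β * z)) * T (t + z) := by
    intro z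
    rw [theta_shift, ← Complex.exp_add, hT, ht, hc]
    congr 1
    · congr 1; ring
    · simp only; congr 1; ring
  simp only [hS] at hS0 ⊢
  simp only [mul_zero, neg_zero, Complex.exp_zero, mul_one, add_zero] at hS0 ⊢
  have hTt : T t ≠ 0 := right_ne_zero_of_mul hS0
  have hTuv : ∀ i j, T (u i - v j) ≠ 0 := fun i j => theta_half_ne_zero (huv i j)
  have hz : {z | T z = 0}.Countable := by
    have : {z | T z = 0} = lattice τ := by
      ext z; exact theta_half_eq_zero_iff
    rw [this]
    exact countable_lattice τ
  have hmain := frobenius_det (θ := T) (differentiable_theta _ _ τ).continuous hz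
    (theta_half_three_term τ) u v hTuv hTt
  have hmat : (Matrix.of fun i j => kronecker α β τ (u i - v j))
      = Matrix.of fun i j => (T0 * Complex.exp (-(β * u i))) *
        (Matrix.of fun i j => Complex.exp (β * v j) *
          (Matrix.of fun i j => T (u i - v j + t) / (T t * T (u i - v j))) i j) i j := by
    ext i j
    simp only [Matrix.of_apply, kronecker, hS]
    have h1 := hTuv i j
    have h2 := Complex.exp_ne_zero c
    have h3 : Complex.exp (-(β * (u i - v j)))
        = Complex.exp (-(β * u i)) * Complex.exp (β * v j) := by
      rw [← Complex.exp_add]; congr 1; ring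
    change T0 / _ * (_ / T _) = _
    rw [h3, add_comm (u i - v j) t]
    simp only [mul_zero, neg_zero, Complex.exp_zero, mul_one, add_zero]
    field_simp
  rw [hmat, Matrix.det_mul_column, Matrix.det_mul_row, hmain]
  have he : Complex.exp (-(β * (∑ i, u i - ∑ j, v j)))
      = (∏ i, Complex.exp (-(β * u i))) * ∏ j, Complex.exp (β * v j) := by
    rw [← Complex.exp_sum, ← Complex.exp_sum, ← Complex.exp_add, Finset.sum_neg_distrib,
      ← Finset.mul_sum, ← Finset.mul_sum]
    congr 1; ring
  rw [he, prod_mul_distrib, prod_const, card_univ, Fintype.card_fin]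
  have h2 := Complex.exp_ne_zero c
  field_simp

lemma leading_theta_neg (τ : ℍ) (z : ℂ) :
    leading (fun z => theta (1 / 2) (1 / 2) (-z) τ) z
      = -leading (fun z => theta (1 / 2) (1 / 2) z τ) z := by
  unfold leading
  split_ifs
  · rw [deriv_comp_neg (fun z => theta (1 / 2) (1 / 2) z τ), neg_zero]
  · exact theta_half_neg z τ

/-- The confluent determinant for sequences with repetitions. -/
theorem det_kronecker_confluent {α β : ℝ} {τ : ℍ}
    (hαβ : (multiplier α, multiplier β) ≠ ((1, 1) : ℂ × ℂ))
    {N : ℕ} (X Y : Fin N → ℂ) (hXY : ∀ i j, X i - Y j ∉ lattice τ) :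
    (Matrix.of fun a b => D (multiplier α) (multiplier β) (repeatCount X a + 1)
        (repeatCount Y b + 1) (X a - Y b) τ).det
      = theta (1 / 2 - β) (1 / 2 + α) (∑ i, X i - ∑ j, Y j) τ / theta (1 / 2 - β) (1 / 2 + α) 0 τ *
        deriv (fun z => theta (1 / 2) (1 / 2) z τ) 0 ^ N *
        ((∏ a, ∏ b ∈ Iio a, leading (fun z => theta (1 / 2) (1 / 2) z τ) (X a - X b)) *
          ∏ a, ∏ b ∈ Iio a, -leading (fun z => theta (1 / 2) (1 / 2) z τ) (Y a - Y b)) /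
          ∏ i, ∏ j, theta (1 / 2) (1 / 2) (X i - Y j) τ := by
  set T : ℂ → ℂ := fun z => theta (1 / 2) (1 / 2) z τ with hT
  have hTd : Differentiable ℂ T := differentiable_theta _ _ τ
  set T0 := deriv T 0
  set S : ℂ → ℂ := fun z => theta (1 / 2 - β) (1 / 2 + α) z τ with hS
  have hSd : Differentiable ℂ S := differentiable_theta _ _ τ
  set K := kronecker α β τ with hK
  have hKan := analyticOnNhd_kronecker α β τ
  have hlo := isOpen_compl_lattice τ
  -- rows
  have rows : ∀ Y : Fin N → ℂ, (∀ i j, X i - Y j ∉ lattice τ) →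
      (Matrix.of fun a b => iteratedDeriv (repeatCount X a) K (X a - Y b)
        / (repeatCount X a).factorial).det
      = (S (∑ a, X a - ∑ j, Y j) / S 0 * T0 ^ N * ∏ a, ∏ b ∈ Iio a, T (Y b - Y a)) *
        (∏ a, ∏ j, (T (X a - Y j))⁻¹) * ∏ a, ∏ b ∈ Iio a, leading T (X a - X b) := by
    intro Y hXY
    have hUo : IsOpen {u : ℂ | ∀ j, u - Y j ∉ lattice τ} := by
      simp only [Set.ofPred_forall]
      exact isOpen_iInter_of_finite fun j => hlo.preimage (continuous_id.sub continuous_const)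
    have := det_confluent (f := fun b u => K (u - Y b)) (θ := T)
      (S := fun w => S (w - ∑ j, Y j) / S 0 * T0 ^ N * ∏ a, ∏ b ∈ Iio a, T (Y b - Y a))
      (h := fun u => ∏ j, (T (u - Y j))⁻¹) hUo
      (fun b u hu => AnalyticAt.fun_comp (f := fun u : ℂ => u - Y b) (hKan _ (hu b)) (by fun_prop))
      hTd (theta_half_zero τ) (by fun_prop)
      (fun u hu => Finset.analyticAt_fun_prod _ fun j _ => AnalyticAt.fun_inv
        ((hTd.comp (differentiable_id.sub_const (Y j))).analyticAt u)
        (theta_half_ne_zero (hu j)))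
      (fun X hX => by
        rw [det_kronecker hαβ X Y hX]
        simp only [prod_inv_distrib]
        change S _ / S 0 * T0 ^ N * ((∏ a, ∏ b ∈ Iio a, T (X a - X b)) *
          ∏ a, ∏ b ∈ Iio a, T (Y b - Y a)) / ∏ i, ∏ j, T (X i - Y j) = _
        ring) X (fun a j => hXY a j)
    rw [← this]
    congr 1
    ext a b
    simp only [Matrix.of_apply, iteratedDeriv_comp_sub_const]
  -- columns
  have hUo : IsOpen {v : ℂ | ∀ i, X i - v ∉ lattice τ} := by
    simp only [Set.ofPred_forall]
    exact isOpen_iInter_of_finite fun j => hlo.preimage (continuous_const.sub continuous_id)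
  -- The evaluation `rows` holds for every admissible `Y`, repeated or not, so its transpose is the
  -- base case for merging columns. The pair factors are `T (Y b - Y a)`, hence the reflected
  -- function as `θ`.
  have cols := det_confluent (f := fun a v => iteratedDeriv (repeatCount X a) K (X a - v)
        / (repeatCount X a).factorial) (θ := fun z => T (-z))
      (S := fun w => S (∑ a, X a - w) / S 0 * T0 ^ N *
        ∏ a, ∏ b ∈ Iio a, leading T (X a - X b))
      (h := fun v => ∏ i, (T (X i - v))⁻¹) hUo
      (fun b u hu => by
        have h1 : AnalyticAt ℂ (iteratedDeriv (repeatCount X b) K) (X b - u) := by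
          rw [iteratedDeriv_eq_iterate]
          exact hKan.iterated_deriv _ _ (hu b)
        exact (AnalyticAt.fun_comp (f := fun u : ℂ => X b - u) h1 (by fun_prop)).fun_div
          analyticAt_const (by exact_mod_cast Nat.factorial_ne_zero _))
      (by fun_prop) (by simp only [neg_zero]; exact theta_half_zero τ) (by fun_prop)
      (fun u hu => Finset.analyticAt_fun_prod _ fun j _ => AnalyticAt.fun_inv
        ((hTd.comp (differentiable_id.const_sub (X j))).analyticAt u)
        (theta_half_ne_zero (hu j)))
      (fun Y hY => by
        rw [← Matrix.det_transpose]
        have := rows Y fun i j => hY j i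
        rw [show ∏ a, ∏ j, (T (X a - Y j))⁻¹ = ∏ j, ∏ a, (T (X a - Y j))⁻¹ from
          Finset.prod_comm] at this
        simp only [neg_sub]
        rw [show ∀ p q r s : ℂ, p * q * r * s = (p * s) * r * q by intros; ring]
        refine Eq.trans ?_ (this.trans (by ring))
        rfl) Y (fun a j => hXY j a)
  rw [← Matrix.det_transpose] at cols
  have hmat : (Matrix.of fun a b => D (multiplier α) (multiplier β) (repeatCount X a + 1)
        (repeatCount Y b + 1) (X a - Y b) τ)
      = (Matrix.of fun a b => iteratedDeriv (repeatCount Y a)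
        (fun v => iteratedDeriv (repeatCount X b) K (X b - v) / (repeatCount X b).factorial) (Y a)
        / (repeatCount Y a).factorial).transpose := by
    ext a b
    simp only [Matrix.of_apply, Matrix.transpose_apply]
    set k := repeatCount X a
    set l := repeatCount Y b
    -- P₁ equals `K` only off the lattice; that complement is open, so the germs at X a - Y b agree
    -- and hence all derivatives do.
    have hP : iteratedDeriv (k + l) (fun w => P1 (multiplier α) (multiplier β) w τ) (X a - Y b)
        = iteratedDeriv (k + l) K (X a - Y b) := by
      refine Filter.EventuallyEq.iteratedDeriv_eq _ ?_
      filter_upwards [hlo.mem_nhds (hXY a b)] with w hw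
      exact P1_eq_kronecker hαβ hw
    have hd : iteratedDeriv l (fun v => iteratedDeriv k K (X a - v) / k.factorial) (Y b)
        = (-1) ^ l * iteratedDeriv (k + l) K (X a - Y b) / k.factorial := by
      simp only [div_eq_mul_inv]
      rw [iteratedDeriv_mul_const_field, iteratedDeriv_comp_const_sub]
      simp only [iteratedDeriv_eq_iterate, ← Function.iterate_add_apply, smul_eq_mul]
      rw [add_comm k l]
    -- The binomial coefficient in `D` converts the normalisation 1/(k + l)! of P_(k+l+1) into the
    -- two Taylor normalisations 1/k! and 1/l!.
    have hch : ((k + l).choose k : ℂ) / (k + l).factorial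
        = 1 / (k.factorial * l.factorial) := by
      have h1 := Nat.add_choose_mul_factorial_mul_factorial k l
      have h2 : ((k + l).choose k : ℂ) * k.factorial * l.factorial = (k + l).factorial := by
        rw [← h1, Nat.choose_symm_add]
        push_cast
        ring
      have f1 : (k.factorial : ℂ) ≠ 0 := by exact_mod_cast k.factorial_ne_zero
      have f2 : (l.factorial : ℂ) ≠ 0 := by exact_mod_cast l.factorial_ne_zero
      have f3 : ((k + l).factorial : ℂ) ≠ 0 := by exact_mod_cast (k + l).factorial_ne_zero
      field_simp
      linear_combination h2
    rw [hd, D, P, show k + 1 + (l + 1) - 1 - 1 = k + l by omega,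
      show k + 1 + (l + 1) - 2 = k + l by omega, show k + 1 - 1 = k by omega, hP]
    have hs : ((-1 : ℂ)) ^ (k + 1 + 1) * (-1) ^ (k + l) = (-1) ^ l := by
      rw [← pow_add, show k + 1 + 1 + (k + l) = 2 * (k + 1) + l by ring, pow_add, pow_mul]
      simp
    calc _ = ((-1 : ℂ) ^ (k + 1 + 1) * (-1) ^ (k + l)) *
          (((k + l).choose k : ℂ) / (k + l).factorial) * iteratedDeriv (k + l) K (X a - Y b) := by
          ring
      _ = _ := by rw [hs, hch]; field_simp
  rw [hmat, cols]
  have hneg : ∀ z, leading (fun z => T (-z)) z = -leading T z := leading_theta_neg τ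
  simp only [hneg]
  rw [Finset.prod_comm (f := fun i j => theta (1 / 2) (1 / 2) (X i - Y j) τ)]
  simp only [prod_inv_distrib]
  change _ = S _ / S 0 * T0 ^ N * _ / ∏ j, ∏ i, T (X i - Y j)
  ring

/-! ### Bookkeeping for blocks of indices. -/

lemma finSigmaFinEquiv_lt_of_lex {r : ℕ} {m : Fin r → ℕ} {p t : (i : Fin r) × Fin (m i)}
    (h : p.1 < t.1 ∨ p.1 = t.1 ∧ (p.2 : ℕ) < t.2) : finSigmaFinEquiv p < finSigmaFinEquiv t := by
  set f : ℕ → ℕ := fun i => if h : i < r then m ⟨i, h⟩ else 0 with hf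
  have hval : ∀ p : (i : Fin r) × Fin (m i),
      (finSigmaFinEquiv p : ℕ) = ∑ i ∈ range p.1, f i + p.2 := by
    intro p
    rw [finSigmaFinEquiv_apply, ← Fin.sum_univ_eq_sum_range]
    congr 1
    refine Finset.sum_congr rfl fun i _ => ?_
    simp only [hf]
    rw [dif_pos (i.2.trans p.1.2)]
    rfl
  rw [Fin.lt_def, hval, hval]
  rcases h with h | ⟨h1, h2⟩
  · have h3 : ∑ i ∈ range (p.1 + 1), f i ≤ ∑ i ∈ range t.1, f i :=
      Finset.sum_le_sum_of_subset (Finset.range_mono (Fin.lt_def.1 h))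
    rw [Finset.sum_range_succ] at h3
    have h4 : f p.1 = m p.1 := by simp [hf]
    have := p.2.2
    omega
  · have h3 : (p.1 : ℕ) = t.1 := congrArg Fin.val h1
    rw [h3]
    omega

lemma finSigmaFinEquiv_lt_iff {r : ℕ} {m : Fin r → ℕ} {p t : (i : Fin r) × Fin (m i)} :
    finSigmaFinEquiv p < finSigmaFinEquiv t ↔ p.1 < t.1 ∨ p.1 = t.1 ∧ (p.2 : ℕ) < t.2 := by
  refine ⟨fun h => ?_, finSigmaFinEquiv_lt_of_lex⟩
  by_contra hc
  push Not at hc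
  obtain ⟨h1, h2⟩ := hc
  rcases h1.lt_or_eq with h3 | h3
  · exact absurd (finSigmaFinEquiv_lt_of_lex (Or.inl h3)) h.not_gt
  · rcases (h2 h3.symm).lt_or_eq with h4 | h4
    · exact absurd (finSigmaFinEquiv_lt_of_lex (Or.inr ⟨h3, h4⟩)) h.not_gt
    · obtain ⟨i, a⟩ := p
      obtain ⟨j, b⟩ := t
      obtain rfl : j = i := h3
      obtain rfl : b = a := Fin.ext h4
      exact lt_irrefl _ h

section

variable {r N : ℕ} {m : Fin r → ℕ}

/-- The block and the position in it of the `a`-th index. -/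
def blockIndex (h : N = ∑ i, m i) (a : Fin N) : (i : Fin r) × Fin (m i) :=
  finSigmaFinEquiv.symm (Fin.cast h a)

lemma prod_blockIndex (h : N = ∑ i, m i) (g : (i : Fin r) × Fin (m i) → ℂ) :
    ∏ a, g (blockIndex h a) = ∏ i, ∏ s : Fin (m i), g ⟨i, s⟩ := by
  subst h
  rw [← Fintype.prod_sigma', ← finSigmaFinEquiv.symm.prod_comp]
  rfl

lemma sum_blockIndex (h : N = ∑ i, m i) (x : Fin r → ℂ) :
    ∑ a, x (blockIndex h a).1 = ∑ i, (m i : ℂ) * x i := by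
  subst h
  have : ∑ a, x (blockIndex (m := m) rfl a).1 = ∑ p : (i : Fin r) × Fin (m i), x p.1 := by
    rw [← finSigmaFinEquiv.symm.sum_comp]
    rfl
  rw [this, Fintype.sum_sigma]
  simp

lemma lt_iff_blockIndex (h : N = ∑ i, m i) (a b : Fin N) : b < a ↔
    (blockIndex h b).1 < (blockIndex h a).1 ∨ (blockIndex h b).1 = (blockIndex h a).1 ∧
      ((blockIndex h b).2 : ℕ) < (blockIndex h a).2 := by
  subst h
  rw [← finSigmaFinEquiv_lt_iff]
  simp [blockIndex]

/-- Distinct blocks carry distinct points, so the earlier equal entries are exactly the earlier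
positions of the same block. Thus the Taylor order at an index is its position in the block. -/
lemma repeatCount_block (h : N = ∑ i, m i) {x : Fin r → ℂ} (hx : Function.Injective x)
    (a : Fin N) :
    repeatCount (fun a => x (blockIndex h a).1) a = (blockIndex h a).2 := by
  have hinj : Function.Injective (blockIndex h) := by
    subst h
    exact finSigmaFinEquiv.symm.injective
  have hsurj : Function.Surjective (blockIndex h) := by
    subst h
    exact finSigmaFinEquiv.symm.surjective
  have himg : ({b ∈ Iio a | x (blockIndex h b).1 = x (blockIndex h a).1} : Finset (Fin N)).map
      ⟨blockIndex h, hinj⟩ = (Iio (blockIndex h a).2).map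
        (Function.Embedding.sigmaMk (β := fun i => Fin (m i)) (blockIndex h a).1) := by
    ext p
    obtain ⟨b, rfl⟩ := hsurj p
    simp only [Finset.mem_map, Finset.mem_filter, Finset.mem_Iio, Function.Embedding.coeFn_mk,
      Function.Embedding.sigmaMk_apply,
      hinj.eq_iff, exists_eq_right, hx.eq_iff, lt_iff_blockIndex h a b]
    generalize blockIndex h a = q
    generalize blockIndex h b = p
    obtain ⟨i, s⟩ := p
    obtain ⟨j, t⟩ := q
    constructor
    · rintro ⟨h1, h2⟩
      obtain rfl : i = j := h2
      have h3 : (s : ℕ) < t := by simpa using h1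
      exact ⟨s, h3, rfl⟩
    · rintro ⟨u, h1, h2⟩
      obtain ⟨rfl, h3⟩ := Sigma.mk.inj_iff.1 h2
      obtain rfl := eq_of_heq h3
      exact ⟨Or.inr ⟨rfl, h1⟩, rfl⟩
  rw [repeatCount, ← Finset.card_map, himg, Finset.card_map, Fin.card_Iio]

/-- Among the pairs b < a, block i contains C(m_i, 2), and m_i m_k join block i to a later block k.
-/
lemma prod_pairs_block (h : N = ∑ i, m i) (g : Fin r → Fin r → ℂ) :
    ∏ a, ∏ b ∈ Iio a, g (blockIndex h b).1 (blockIndex h a).1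
      = (∏ i, g i i ^ (m i).choose 2) * ∏ i, ∏ k ∈ Ioi i, g i k ^ (m i * m k) := by
  have h1 : ∀ a : Fin N, ∏ b ∈ Iio a, g (blockIndex h b).1 (blockIndex h a).1
      = g (blockIndex h a).1 (blockIndex h a).1 ^ ((blockIndex h a).2 : ℕ) *
        ∏ j ∈ Iio (blockIndex h a).1, g j (blockIndex h a).1 ^ m j := by
    intro a
    have h2 : ∏ b ∈ Iio a, g (blockIndex h b).1 (blockIndex h a).1
        = ∏ b, if (blockIndex h b).1 < (blockIndex h a).1 ∨
          (blockIndex h b).1 = (blockIndex h a).1 ∧ ((blockIndex h b).2 : ℕ) < (blockIndex h a).2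
          then g (blockIndex h b).1 (blockIndex h a).1 else 1 := by
      rw [← Finset.prod_filter]
      refine Finset.prod_congr ?_ fun _ _ => rfl
      ext b
      simp [lt_iff_blockIndex h a b]
    rw [h2]
    generalize blockIndex h a = q
    obtain ⟨k, t⟩ := q
    rw [prod_blockIndex h (fun p => if p.1 < k ∨ p.1 = k ∧ (p.2 : ℕ) < t then g p.1 k else 1),
      ← Finset.mul_prod_erase univ _ (Finset.mem_univ k)]
    congr 1
    · simp only [lt_irrefl, false_or, true_and]
      rw [← Finset.prod_filter, Finset.prod_const]
      congr 1
      have : ({s : Fin (m k) | (s : ℕ) < t} : Finset (Fin (m k))) = Iio t := by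
        ext s; simp
      rw [this, Fin.card_Iio]
    · have h3 : ∀ j ∈ univ.erase k, ∏ s : Fin (m j),
          (if j < k ∨ j = k ∧ (s : ℕ) < t then g j k else 1) = if j < k then g j k ^ m j else 1 := by
        intro j hj
        have : j ≠ k := Finset.ne_of_mem_erase hj
        simp only [this, false_and, or_false]
        split_ifs <;> simp
      rw [Finset.prod_congr rfl h3, ← Finset.prod_filter]
      refine Finset.prod_congr ?_ fun _ _ => rfl
      ext j
      simp only [Finset.mem_filter, Finset.mem_erase, Finset.mem_univ, and_true, Finset.mem_Iio]
      exact ⟨fun h => h.2, fun h => ⟨h.ne, h⟩⟩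
  rw [Finset.prod_congr rfl fun a _ => h1 a,
    prod_blockIndex h (fun p => g p.1 p.1 ^ (p.2 : ℕ) * ∏ j ∈ Iio p.1, g j p.1 ^ m j)]
  simp only [prod_mul_distrib, Finset.prod_const, card_univ, Fintype.card_fin]
  congr 1
  · refine Finset.prod_congr rfl fun i _ => ?_
    rw [Finset.prod_pow_eq_pow_sum, Fin.sum_univ_eq_sum_range (fun s => s), Finset.sum_range_id,
      Nat.choose_two_right]
  · simp only [← Finset.prod_pow, ← pow_mul]
    exact Finset.prod_comm' (by simp)

/-- The number of pairs of indices in different blocks. -/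
def crossPairs (m : Fin r → ℕ) : ℕ := ∑ i, ∑ k ∈ Ioi i, m i * m k

lemma choose_two_eq_add_crossPairs (h : N = ∑ i, m i) :
    N.choose 2 = ∑ i, (m i).choose 2 + crossPairs m := by
  -- The count of pairs is read off as the exponent of a constant product.
  have h1 := prod_pairs_block h (fun _ _ => 2)
  simp only [Finset.prod_const, Finset.prod_pow_eq_pow_sum, ← pow_add, Fin.card_Iio] at h1
  have h2 : (2 : ℕ) ^ (∑ a : Fin N, (a : ℕ)) = 2 ^ (∑ i, (m i).choose 2 + crossPairs m) := by
    exact_mod_cast h1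
  have h3 := Nat.pow_right_injective le_rfl h2
  rw [← h3, Fin.sum_univ_eq_sum_range (fun s => s), Finset.sum_range_id, Nat.choose_two_right]

/-- Pairs within a block give ϑ₁'(0). Pairs across blocks appear as later minus earlier, opposite to
the theta quotient, so each costs a sign by oddness. -/
lemma prod_leading_block (τ : ℍ) (h : N = ∑ i, m i) (x : Fin r → ℂ)
    (hx : ∀ i k, i < k → x i - x k ∉ lattice τ) :
    ∏ a, ∏ b ∈ Iio a, leading (fun z => theta (1 / 2) (1 / 2) z τ)
        (x (blockIndex h a).1 - x (blockIndex h b).1)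
      = deriv (fun z => theta (1 / 2) (1 / 2) z τ) 0 ^ (∑ i, (m i).choose 2) *
        ((-1) ^ crossPairs m *
          ∏ i, ∏ k ∈ Ioi i, theta (1 / 2) (1 / 2) (x i - x k) τ ^ (m i * m k)) := by
  rw [prod_pairs_block h (fun i k => leading (fun z => theta (1 / 2) (1 / 2) z τ) (x k - x i))]
  congr 1
  · rw [← Finset.prod_pow_eq_pow_sum]
    simp [leading]
  · rw [crossPairs, ← Finset.prod_pow_eq_pow_sum, ← Finset.prod_mul_distrib]
    refine Finset.prod_congr rfl fun i _ => ?_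
    rw [← Finset.prod_pow_eq_pow_sum, ← Finset.prod_mul_distrib]
    refine Finset.prod_congr rfl fun k hk => ?_
    have hne : x k - x i ≠ 0 := by
      intro h0
      refine hx i k (Finset.mem_Ioi.1 hk) ⟨0, 0, ?_⟩
      simp only [Int.cast_zero, zero_mul, add_zero, mul_zero]
      linear_combination -h0
    rw [leading, if_neg hne, ← mul_pow, ← neg_sub, theta_half_neg]
    ring

lemma injective_of_not_mem_lattice {τ : ℍ} {x : Fin r → ℂ}
    (hx : ∀ i k, i < k → x i - x k ∉ lattice τ) : Function.Injective x := by
  have h0 : (0 : ℂ) ∈ lattice τ := ⟨0, 0, by simp⟩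
  intro i k hik
  rcases lt_trichotomy i k with h | h | h
  · exact absurd (by rwa [hik, sub_self]) (hx i k h)
  · exact h
  · exact absurd (by rwa [hik, sub_self]) (hx k i h)

end

/-! ### Evaluation of the block determinant, the exponent Φ and the signs. -/

lemma detD_eq {α β : ℝ} {τ : ℍ} (hαβ : (multiplier α, multiplier β) ≠ ((1, 1) : ℂ × ℂ))
    {r s : ℕ} (m : Fin r → ℕ) (n : Fin s → ℕ) (hmn : ∑ i, m i = ∑ j, n j)
    (x : Fin r → ℂ) (y : Fin s → ℂ) (hxy : ∀ i j, x i - y j ∉ lattice τ)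
    (hx : ∀ i k, i < k → x i - x k ∉ lattice τ) (hy : ∀ j l, j < l → y j - y l ∉ lattice τ) :
    detD (multiplier α) (multiplier β) τ m n hmn x y
      = theta (1 / 2 - β) (1 / 2 + α) (∑ i, (m i : ℂ) * x i - ∑ j, (n j : ℂ) * y j) τ /
          theta (1 / 2 - β) (1 / 2 + α) 0 τ *
        (deriv (fun z => theta (1 / 2) (1 / 2) z τ) 0 ^
          (∑ i, m i + ∑ i, (m i).choose 2 + ∑ j, (n j).choose 2) *
        (-1) ^ (crossPairs m + crossPairs n + (∑ i, m i).choose 2)) *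
        ((∏ i, ∏ k ∈ Ioi i, theta (1 / 2) (1 / 2) (x i - x k) τ ^ (m i * m k)) *
          ∏ j, ∏ l ∈ Ioi j, theta (1 / 2) (1 / 2) (y j - y l) τ ^ (n j * n l)) /
        ∏ i, ∏ j, theta (1 / 2) (1 / 2) (x i - y j) τ ^ (m i * n j) := by
  set X : Fin (∑ i, m i) → ℂ := fun a => x (blockIndex rfl a).1 with hX
  set Y : Fin (∑ i, m i) → ℂ := fun a => y (blockIndex hmn a).1 with hY
  have hmat : (blockD (multiplier α) (multiplier β) τ m n x y).submatrix
      (fun u : Fin (∑ i, m i) => finSigmaFinEquiv.symm u)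
      (fun u : Fin (∑ i, m i) => finSigmaFinEquiv.symm (Fin.cast hmn u))
      = Matrix.of fun a b => D (multiplier α) (multiplier β) (repeatCount X a + 1)
        (repeatCount Y b + 1) (X a - Y b) τ := by
    ext a b
    rw [Matrix.of_apply, hX, hY, repeatCount_block rfl (injective_of_not_mem_lattice hx),
      repeatCount_block hmn (injective_of_not_mem_lattice hy)]
    rfl
  have hden : ∏ a, ∏ b, theta (1 / 2) (1 / 2) (X a - Y b) τ
      = ∏ i, ∏ j, theta (1 / 2) (1 / 2) (x i - y j) τ ^ (m i * n j) := by
    rw [hX, prod_blockIndex rfl (fun p => ∏ b, theta (1 / 2) (1 / 2) (x p.1 - Y b) τ)]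
    refine Finset.prod_congr rfl fun i _ => ?_
    rw [Finset.prod_const (∏ b, theta (1 / 2) (1 / 2) (x i - Y b) τ), card_univ,
      Fintype.card_fin, hY, prod_blockIndex hmn (fun p => theta (1 / 2) (1 / 2) (x i - y p.1) τ), ← Finset.prod_pow]
    refine Finset.prod_congr rfl fun j _ => ?_
    rw [Finset.prod_const (theta (1 / 2) (1 / 2) (x i - y j) τ), card_univ, Fintype.card_fin,
      ← pow_mul, mul_comm]
  have hneg : ∏ a, ∏ b ∈ Iio a, -leading (fun z => theta (1 / 2) (1 / 2) z τ) (Y a - Y b)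
      = (-1) ^ (∑ i, m i).choose 2 *
        ∏ a, ∏ b ∈ Iio a, leading (fun z => theta (1 / 2) (1 / 2) z τ) (Y a - Y b) := by
    simp only [Finset.prod_neg, Fin.card_Iio, Finset.prod_mul_distrib]
    rw [Finset.prod_pow_eq_pow_sum, Fin.sum_univ_eq_sum_range (fun s => s), Finset.sum_range_id,
      Nat.choose_two_right]
  rw [detD, hmat, det_kronecker_confluent hαβ X Y fun i j => hxy _ _, hden, hneg,
    prod_leading_block τ rfl x hx, prod_leading_block τ hmn y hy, sum_blockIndex, sum_blockIndex,
    pow_add, pow_add, pow_add, pow_add]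
  ring

/-- Φ is N² minus the two counts of cross pairs. Writing N² = N + 2 C(N, 2) and splitting one C(N,
2) along m and the other along n cancels those counts. In particular Φ ≥ 0, which turns integer
powers into natural ones. -/
lemma Phi_eq {r s : ℕ} (m : Fin r → ℕ) (n : Fin s → ℕ) (hmn : ∑ i, m i = ∑ j, n j) :
    Phi m n = ((∑ i, m i + ∑ i, (m i).choose 2 + ∑ j, (n j).choose 2 : ℕ) : ℤ) := by
  have h1 := choose_two_eq_add_crossPairs (m := m) rfl
  have h2 := choose_two_eq_add_crossPairs (m := n) hmn
  set N := ∑ i, m i with hN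
  have h3 : Phi m n = (N : ℤ) * N - crossPairs m - crossPairs n := by
    have hNN : (N : ℤ) * N = ∑ i, ∑ j, (m i : ℤ) * n j := by
      rw [← Finset.sum_mul_sum]
      congr 1
      · rw [hN]; push_cast; rfl
      · rw [hmn]; push_cast; rfl
    rw [hNN, Phi, crossPairs, crossPairs]
    push_cast
    rfl
  have h4 : (N : ℤ) * N = N + 2 * N.choose 2 := by
    have h5 : (N + 1).choose 2 = N.choose 2 + N := by
      rw [Nat.choose_succ_succ' N 1, Nat.choose_one_right]; ring
    have h6 := Nat.choose_two_right N
    have h7 : N * (N - 1) = 2 * N.choose 2 := by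
      rw [h6]
      exact (Nat.mul_div_cancel' (Nat.even_mul_pred_self N).two_dvd).symm
    rcases N with _ | k
    · simp
    · rw [Nat.add_sub_cancel] at h7
      have h8 : (((k + 1) * k : ℕ) : ℤ) = ((2 * (k + 1).choose 2 : ℕ) : ℤ) := by rw [h7]
      push_cast at h8 ⊢
      linarith
  rw [h3, h4]
  push_cast
  have h1' : (N.choose 2 : ℤ) = ∑ i, ((m i).choose 2 : ℤ) + crossPairs m := by exact_mod_cast h1
  have h2' : (N.choose 2 : ℤ) = ∑ i, ((n i).choose 2 : ℤ) + crossPairs n := by exact_mod_cast h2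
  linarith

/-- The determinant formula for the powers of `η³ = ϑ₁'(0) / i`. -/
theorem eta_zpow_eq_thetaDet (α β : ℝ) (τ : ℍ)
    (hαβ : (multiplier α, multiplier β) ≠ ((1, 1) : ℂ × ℂ))
    {r s : ℕ} (m : Fin r → ℕ) (n : Fin s → ℕ) (hmn : ∑ i, m i = ∑ j, n j)
    (x : Fin r → ℂ) (y : Fin s → ℂ)
    (hxy : ∀ i j, x i - y j ∉ lattice τ)
    (hx : ∀ i k, i < k → x i - x k ∉ lattice τ)
    (hy : ∀ j l, j < l → y j - y l ∉ lattice τ)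
    (hden : theta (1 / 2 - β) (1 / 2 + α)
      (∑ i, (m i : ℂ) * x i - ∑ j, (n j : ℂ) * y j) τ ≠ 0) :
    ModularForm.eta (τ : ℂ) ^ (3 * Phi m n)
      = (-Complex.I) ^ Phi m n
        * (-1) ^ (Phi m n + ((∑ i, m i) * (∑ i, m i + 1) / 2 : ℕ))
        * thetaDet α β τ m n hmn x y := by
  have h1 := choose_two_eq_add_crossPairs (m := m) rfl
  have h2 := choose_two_eq_add_crossPairs (m := n) hmn
  have h0 := theta_shifted_zero_ne_zero τ hαβ
  have hpx : ∏ i, ∏ k ∈ Finset.Ioi i, theta (1 / 2) (1 / 2) (x i - x k) τ ^ (m i * m k) ≠ 0 :=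
    Finset.prod_ne_zero_iff.2 fun i _ => Finset.prod_ne_zero_iff.2 fun k hk =>
      pow_ne_zero _ (theta_half_ne_zero (hx i k (Finset.mem_Ioi.1 hk)))
  have hpy : ∏ j, ∏ l ∈ Finset.Ioi j, theta (1 / 2) (1 / 2) (y j - y l) τ ^ (n j * n l) ≠ 0 :=
    Finset.prod_ne_zero_iff.2 fun i _ => Finset.prod_ne_zero_iff.2 fun k hk =>
      pow_ne_zero _ (theta_half_ne_zero (hy i k (Finset.mem_Ioi.1 hk)))
  have hpxy : ∏ i, ∏ j, theta (1 / 2) (1 / 2) (x i - y j) τ ^ (m i * n j) ≠ 0 :=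
    Finset.prod_ne_zero_iff.2 fun i _ => Finset.prod_ne_zero_iff.2 fun k _ =>
      pow_ne_zero _ (theta_half_ne_zero (hxy i k))
  have hdet : thetaDet α β τ m n hmn x y
      = deriv (fun z => theta (1 / 2) (1 / 2) z τ) 0 ^
        (∑ i, m i + ∑ i, (m i).choose 2 + ∑ j, (n j).choose 2) *
        (-1) ^ (crossPairs m + crossPairs n + (∑ i, m i).choose 2) := by
    rw [thetaDet, detD_eq hαβ m n hmn x y hxy hx hy, bigTheta]
    generalize deriv (fun z => theta (1 / 2) (1 / 2) z τ) 0 ^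
      (∑ i, m i + ∑ i, (m i).choose 2 + ∑ j, (n j).choose 2) *
      (-1) ^ (crossPairs m + crossPairs n + (∑ i, m i).choose 2) = C
    generalize ∏ i, ∏ k ∈ Finset.Ioi i, theta (1 / 2) (1 / 2) (x i - x k) τ ^ (m i * m k) = A
      at *
    generalize ∏ j, ∏ l ∈ Finset.Ioi j, theta (1 / 2) (1 / 2) (y j - y l) τ ^ (n j * n l) = B
      at *
    generalize ∏ i, ∏ j, theta (1 / 2) (1 / 2) (x i - y j) τ ^ (m i * n j) = E at *
    generalize theta (1 / 2 - β) (1 / 2 + α) 0 τ = s0 at *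
    generalize theta (1 / 2 - β) (1 / 2 + α)
      (∑ i, (m i : ℂ) * x i - ∑ j, (n j : ℂ) * y j) τ = s1 at *
    field_simp
  rw [hdet, Phi_eq m n hmn, deriv_theta_half_zero]
  set N := ∑ i, m i with hN
  set p := N + ∑ i, (m i).choose 2 + ∑ j, (n j).choose 2 with hp
  have htri : N * (N + 1) / 2 = N.choose 2 + N := by
    have h5 : (N + 1).choose 2 = N.choose 2 + N := by
      rw [Nat.choose_succ_succ' N 1, Nat.choose_one_right]; ring
    rw [← h5, Nat.choose_two_right, Nat.add_sub_cancel, mul_comm]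
  have e1 : (3 * (p : ℤ)) = ((3 * p : ℕ) : ℤ) := by push_cast; ring
  rw [e1, ← Nat.cast_add, zpow_natCast, zpow_natCast, zpow_natCast, htri]
  -- Since p plus the two numbers of cross pairs is N + 2 C(N, 2), the total exponent is 2(N + 2
  -- C(N, 2)).
  have hsign : (-1 : ℂ) ^ (p + (N.choose 2 + N))
      * (-1) ^ (crossPairs m + crossPairs n + N.choose 2) = 1 := by
    rw [← pow_add]
    refine Even.neg_one_pow ⟨N + 2 * N.choose 2, ?_⟩
    omega
  -- The factor (-i)^Φ cancels the i^Φ coming from ϑ₁'(0) = i η³.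
  have hI : (-Complex.I) ^ p * Complex.I ^ p = 1 := by
    rw [← mul_pow, neg_mul, Complex.I_mul_I, neg_neg, one_pow]
  rw [mul_pow Complex.I, ← pow_mul]
  linear_combination -(ModularForm.eta (τ : ℂ) ^ (3 * p)) *
    ((-1 : ℂ) ^ (p + (N.choose 2 + N)) * (-1) ^ (crossPairs m + crossPairs n + N.choose 2) * hI
      + hsign)

end Garvan

end

theorem mainTheorem2 (α β : ℝ) (τ : ℍ)
    (hαβ : (Garvan.multiplier α, Garvan.multiplier β) ≠ ((1, 1) : ℂ × ℂ))
    {r s : ℕ} (m : Fin r → ℕ) (n : Fin s → ℕ) (hmn : ∑ i, m i = ∑ j, n j)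
    (x : Fin r → ℂ) (y : Fin s → ℂ)
    (hxy : ∀ i j, x i - y j ∉ Garvan.lattice τ)
    (hx : ∀ i k, i < k → x i - x k ∉ Garvan.lattice τ)
    (hy : ∀ j l, j < l → y j - y l ∉ Garvan.lattice τ)
    (hden : Garvan.theta (1 / 2 - β) (1 / 2 + α)
      (∑ i, (m i : ℂ) * x i - ∑ j, (n j : ℂ) * y j) τ ≠ 0) :
    ModularForm.eta (τ : ℂ) ^ (3 * Garvan.Phi m n)
        = (-Complex.I) ^ Garvan.Phi m n
          * (-1) ^ (Garvan.Phi m n + ((∑ i, m i) * (∑ i, m i + 1) / 2 : ℕ))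
          * Garvan.thetaDet α β τ m n hmn x y ∧
      ∀ ζ : ℤ, Garvan.Phi m n = 8 * ζ →
        ModularForm.discriminant τ ^ ζ
          = (-Complex.I) ^ Garvan.Phi m n
            * (-1) ^ (Garvan.Phi m n + ((∑ i, m i) * (∑ i, m i + 1) / 2 : ℕ))
            * Garvan.thetaDet α β τ m n hmn x y := by
  have hmain := Garvan.eta_zpow_eq_thetaDet α β τ hαβ m n hmn x y hxy hx hy hden
  refine ⟨hmain, fun ζ hζ => ?_⟩
  rw [← hmain, hζ, ModularForm.discriminant, ← zpow_natCast, ← zpow_mul]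
  congr 1
  push_cast
  ring
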